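/- **Conventions.** We work in NBG set theory. Let $\mathbf R$ be an ordered field and $(\mathfrak N,\cdot,1,\prec)$ a non-trivial linearly ordered Abelian group, possibly a proper class. $\mathbb T=\mathbf R[[\mathfrak N]]$ is the ordered field of functions $s:\mathfrak N\to\mathbf R$ whose support $\operatorname{supp}s$ is a set that is well-ordered by the reverse order $\succ$ (well-based), with the Cauchy product, where $s>0$ iff $s\neq 0$ and $s(\mathfrak d(s))>0$ for $\mathfrak d(s):=\max\operatorname{supp}s$; $\mathbf R$ and $\mathfrak N$ are identified with their images in $\mathbb T$. For $s,t\in\mathbb T$ write $s\prec t$ if $r|s|<|t|$ for all $r\in\mathbf R^{>}$, and $s\preccurlyeq t$ if not $t\prec s$. Write $\mathbb T^{>,\succ}=\{s: s>\mathbf R\}$. A family $(s_i)_{i\in I}$ is summable if $\bigcup_i\operatorname{supp}s_i$ is a well-based set and each monomial lies in $\operatorname{supp} s_i$ for only finitely many $i$; its sum is then taken coefficientwise. An $\mathbf R$-linear map is strongly linear if it maps summable families to summable families and preserves their sums. **Setting.** Let $\log:\mathbb T^{>}\to\mathbb T$ be an embedding of ordered groups (from $\cdot$ to $+$) such that $\operatorname{supp}\log\mathfrak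 m\succ 1$ for all $\mathfrak m\in\mathfrak N$; $\log s\le s-1$ for all $s>0$; $\log(1+\varepsilon)=\sum_{k>0}\frac{(-1)^{k+1}}{k}\varepsilon^k$ for all $\varepsilon\prec1$; and $\log$ restricts to an isomorphism $\mathbf R^{>}\to\mathbf R$. Assume that $\log$ is surjective ($\mathbb T$ is exponentially closed). For $s,t\ne0$ say that $s$ is strictly flatter than $t$ if $\log|s|\prec\log|t|$, and flatter than $t$ if $\log|s|\preccurlyeq\log|t|$. Let $\partial:\mathbb T\to\mathbb T$, $s\mapsto s'$, be a strongly linear derivation with $(\log|s|)'=s'/s$ for $s\neq0$, such that $\ker\partial=\mathbf R$ and $s'>0$ for all $s\in\mathbb T^{>,\succ}$ (so that $\mathbb T$ is an H-field). Let $x\in\mathbb T^{>}$ with $1\notin\operatorname{supp}x$ and $x'=1$. Assume that $\partial$ is flat: for all $\mathfrak m\in\mathfrak N$ and $\mathfrak n\in\operatorname{supp}\mathfrak m'$ there are $\mathfrak f,\mathfrak w\in\mathfrak N$ with $\mathfrak n=\mathfrak m\mathfrak f\mathfrak w$, $\mathfrak f$ strictly flatter than $\mathfrak m$, and $\mathfrak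 w$ flatter than $x$. Let $\circ:\mathbb T\times\mathbb T^{>,\succ}\to\mathbb T$ be such that for each $s\in\mathbb T^{>,\succ}$ the map $f\mapsto f\circ s$ is a strongly linear morphism of ordered rings commuting with $\log$, that $f\circ(s\circ t)=(f\circ s)\circ t$ for all $f\in\mathbb T$ and $s,t\in\mathbb T^{>,\succ}$, and that $x\in\mathbb T^{>,\succ}$ is an identity: $x\circ s=s$ and $f\circ x=f$ for all such $f,s$. Assume that $\circ$ is flat: for all $s\in\mathbb T^{>,\succ}$, all $\mathfrak m\in\mathfrak N\setminus\{1\}$ and all $\mathfrak n\in\operatorname{supp}(\mathfrak m\circ s)$ there are $\mathfrak f,\mathfrak w\in\mathfrak N$ with $\mathfrak n=\mathfrak d(\mathfrak m\circ s)\,\mathfrak f\,\mathfrak w$, $\mathfrak f$ strictly flatter than $\mathfrak m\circ s$, $\mathfrak w\preccurlyeq1$, and $\mathfrak w$ flatter than some $\mathfrak u\in\operatorname{supp}s$. Assume the chain rule $(f\circ s)'=s'\cdot(f'\circ s)$ for all $f\in\mathbb T$, $s\in\mathbb T^{>,\succ}$. Assume finally that $\mathbb T$ has Taylor expansions: whenever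 $s\in\mathbb T^{>,\succ}$ and $f,\delta\in\mathbb T$ satisfy $\delta\prec s$ and $(\mathfrak m'\circ s)\delta\prec\mathfrak m\circ s$ for all $\mathfrak m\in\operatorname{supp}f$, the family $((\mathfrak m^{(k)}\circ s)\delta^k)_{\mathfrak m\in\operatorname{supp}f,\,k\in\mathbb N}$ is summable, $$f\circ(s+\delta)=\sum_{k\in\mathbb N}\frac{f^{(k)}\circ s}{k!}\delta^k=\sum_{\mathfrak m\in\operatorname{supp}f,\;k\in\mathbb N}f(\mathfrak m)\frac{\mathfrak m^{(k)}\circ s}{k!}\delta^k,$$ and $(f^{(k+1)}\circ s)\delta^{k+1}\prec(f^{(k)}\circ s)\delta^k$ for every $k\in\mathbb N$ with $(f^{(k+1)}\circ s)\delta^{k+1}\ne0$. Let $\mathfrak M\subseteq\mathfrak N$ be a subgroup containing $x$ and let $\mathbb S=\mathbf R[[\mathfrak M]]\subseteq\mathbb T$ be the subfield of series with support in $\mathfrak M$. Assume that $\mathbb S$ is closed under $\partial$ and that $\mathfrak m\circ(x+\delta)\in\mathbb S$ for all $\mathfrak m\in\mathfrak M$ and all $\delta\in\mathbb S$ with $\delta\prec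 x$. **Theorem 3.1.** The class $\mathcal G=\{x+\delta\in\mathbb S:\delta\prec x\}$ is a group under the composition $\circ$, with identity element $x$. -/

import Mathlib

/-! ### Conventions

Sets are the `u`-small types and classes live in `Type (u + 1)`: a class-sized ordered group of
monomials is a type `𝔑 : Type (u + 1)`, and supports of series are required to be `u`-small. (For
a monomial group that is itself a set, no exponentially closed field of series exists, so the
distinction matters.) -/

universe u w

open scoped HahnSeries

namespace Transserial

section Series

variable (𝔑 : Type (u + 1)) [CommGroup 𝔑] [LinearOrder 𝔑] [IsOrderedMonoid 𝔑]
  (R : Type w) [Field R] [LinearOrder R] [IsStrictOrderedRing R]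

/-- The monomial group, written additively and with the reversed order: Hahn series in Mathlib have
well-ordered sets of exponents, well-based series have reverse well-ordered sets of monomials. -/
abbrev Expo : Type (u + 1) := (Additive 𝔑)ᵒᵈ

theorem aleph0_lt_univ : Cardinal.aleph0 < Cardinal.univ.{u, u + 1} := by
  simp

instance : Fact (Cardinal.aleph0 < Cardinal.univ.{u, u + 1}) := ⟨aleph0_lt_univ⟩

/-- The field `R[[𝔑]]` as a subfield of the lexicographically ordered field of all Hahn series:
the series whose support is a set (is `u`-small). -/
noncomputable def seriesSubfield : Subfield (Lex R⟦Expo 𝔑⟧) where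
  carrier := {s | (ofLex s).cardSupp < Cardinal.univ.{u, u + 1}}
  zero_mem' := (HahnSeries.cardSuppLTSubfield (Expo 𝔑) R Cardinal.univ.{u, u + 1}).zero_mem
  one_mem' := (HahnSeries.cardSuppLTSubfield (Expo 𝔑) R Cardinal.univ.{u, u + 1}).one_mem
  add_mem' := (HahnSeries.cardSuppLTSubfield (Expo 𝔑) R Cardinal.univ.{u, u + 1}).add_mem
  mul_mem' := (HahnSeries.cardSuppLTSubfield (Expo 𝔑) R Cardinal.univ.{u, u + 1}).mul_mem
  neg_mem' := (HahnSeries.cardSuppLTSubfield (Expo 𝔑) R Cardinal.univ.{u, u + 1}).neg_mem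
  inv_mem' _ := (HahnSeries.cardSuppLTSubfield (Expo 𝔑) R Cardinal.univ.{u, u + 1}).inv_mem

theorem mem_seriesSubfield_iff (s : Lex R⟦Expo 𝔑⟧) :
    s ∈ seriesSubfield 𝔑 R ↔ Small.{u} (ofLex s).support := by
  rw [Cardinal.small_iff_lift_mk_lt_univ, Cardinal.lift_id]
  rfl

/-- `R[[𝔑]]`: the linearly ordered field of well-based series with coefficients in `R` and
monomials in `𝔑`. -/
abbrev Series : Type (max (u + 1) w) := ↥(seriesSubfield 𝔑 R)

end Series

variable {𝔑 : Type (u + 1)} [CommGroup 𝔑] [LinearOrder 𝔑] [IsOrderedMonoid 𝔑]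
  {R : Type w} [Field R] [LinearOrder R] [IsStrictOrderedRing R]

/-- The coefficient of the monomial `m` in `s`. -/
def coeff (s : Series 𝔑 R) (m : 𝔑) : R :=
  (ofLex s.1).coeff (OrderDual.toDual (Additive.ofMul m))

def supp (s : Series 𝔑 R) : Set 𝔑 := {m | coeff s m ≠ 0}

/-- The term `r m`, for a coefficient `r` and a monomial `m`. -/
noncomputable def term (r : R) (m : 𝔑) : Series 𝔑 R :=
  ⟨toLex (HahnSeries.single (OrderDual.toDual (Additive.ofMul m)) r),
    (HahnSeries.cardSupp_single_le _ r).trans_lt (Cardinal.one_lt_aleph0.trans aleph0_lt_univ)⟩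

/-- The embedding of `𝔑` into `R[[𝔑]]`. -/
noncomputable def mono (m : 𝔑) : Series 𝔑 R := term 1 m

/-- The embedding of `R` into `R[[𝔑]]`. -/
noncomputable def const (r : R) : Series 𝔑 R := term r 1

/-- `s ≺ t`: every positive scalar multiple of `|s|` is smaller than `|t|`. -/
def Prec (s t : Series 𝔑 R) : Prop := ∀ r : R, 0 < r → const r * |s| < |t|

infix:50 " ≺ " => Prec

/-- `s ≼ t`: the negation of `t ≺ s`. -/
def PrecEq (s t : Series 𝔑 R) : Prop := ¬ t ≺ s

infix:50 " ≼ " => PrecEq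

/-- `s` is positive infinite: `s > R`. -/
def PosInf (s : Series 𝔑 R) : Prop := ∀ r : R, const r < s

/-! ### Summability and strong linearity -/

/-- A well-based set of monomials: a set (i.e. `u`-small) that is well-ordered by `>`. -/
def IsWellBased (A : Set 𝔑) : Prop := Small.{u} A ∧ A.WellFoundedOn (· > ·)

def IsSummable {ι : Type*} (s : ι → Series 𝔑 R) : Prop :=
  IsWellBased (⋃ i, supp (s i)) ∧ ∀ m, {i | m ∈ supp (s i)}.Finite

/-- The family `s` is summable, with sum `t`. -/
def HasStrongSum {ι : Type*} (s : ι → Series 𝔑 R) (t : Series 𝔑 R) : Prop :=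
  IsSummable s ∧ ∀ m, coeff t m = ∑ᶠ i, coeff (s i) m

structure IsStronglyLinear (Φ : Series 𝔑 R → Series 𝔑 R) : Prop where
  map_add : ∀ s t, Φ (s + t) = Φ s + Φ t
  map_const_mul : ∀ (r : R) s, Φ (const r * s) = const r * Φ s
  map_sum : ∀ (ι : Type (u + 1)) (s : ι → Series 𝔑 R) (t : Series 𝔑 R),
    HasStrongSum s t → HasStrongSum (fun i => Φ (s i)) (Φ t)

/-! ### Transserial fields

The logarithm is a function on the positive elements; its values elsewhere are irrelevant and
unconstrained. -/

structure IsTransserialField (log : Series 𝔑 R → Series 𝔑 R) : Prop where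
  log_mul : ∀ s t, 0 < s → 0 < t → log (s * t) = log s + log t
  log_lt_log : ∀ s t, 0 < s → s < t → log s < log t
  one_lt_of_mem_supp_log : ∀ m : 𝔑, ∀ n ∈ supp (log (mono m)), 1 < n
  log_le : ∀ s, 0 < s → log s ≤ s - 1
  log_one_add : ∀ ε : Series 𝔑 R, ε ≺ 1 →
    HasStrongSum (fun k : ℕ => const ((-1) ^ k / ((k : R) + 1)) * ε ^ (k + 1)) (log (1 + ε))
  log_const : ∀ r : R, 0 < r → ∃ a : R, log (const r) = const a
  exists_log_const : ∀ a : R, ∃ r : R, 0 < r ∧ log (const r) = const a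

def IsExponentiallyClosed (log : Series 𝔑 R → Series 𝔑 R) : Prop :=
  ∀ s, ∃ t, 0 < t ∧ log t = s

/-- `s` is strictly flatter than `t` (for non-zero `s`, `t`). -/
def StrictlyFlatter (log : Series 𝔑 R → Series 𝔑 R) (s t : Series 𝔑 R) : Prop :=
  log |s| ≺ log |t|

/-- `s` is flatter than `t` (for non-zero `s`, `t`). -/
def Flatter (log : Series 𝔑 R → Series 𝔑 R) (s t : Series 𝔑 R) : Prop :=
  log |s| ≼ log |t|

/-! ### Derivations -/

structure IsTransserialDerivation (log D : Series 𝔑 R → Series 𝔑 R) : Prop where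
  stronglyLinear : IsStronglyLinear D
  leibniz : ∀ s t, D (s * t) = D s * t + s * D t
  map_log : ∀ s, s ≠ 0 → D (log |s|) = D s / s

/-- `x` is an identity of the derivation `D`. -/
structure IsDerivIdentity (D : Series 𝔑 R → Series 𝔑 R) (x : Series 𝔑 R) : Prop where
  pos : 0 < x
  one_notMem_supp : (1 : 𝔑) ∉ supp x
  deriv_eq_one : D x = 1

structure IsHField (D : Series 𝔑 R → Series 𝔑 R) : Prop where
  ker : ∀ s, D s = 0 ↔ ∃ r : R, s = const r
  deriv_pos : ∀ s, PosInf s → 0 < D s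

/-- Flatness of a derivation `D` with identity `x`. -/
def IsFlatDerivation (log D : Series 𝔑 R → Series 𝔑 R) (x : Series 𝔑 R) : Prop :=
  ∀ m : 𝔑, ∀ n ∈ supp (D (mono m)), ∃ f v : 𝔑,
    StrictlyFlatter (R := R) log (mono f) (mono m) ∧ Flatter log (mono v) x ∧ n = m * f * v

/-! ### Composition laws

A composition law `𝕋 × 𝕋^{>,≻} → 𝕋` is given by a function `comp` of two series, all of whose
properties are only required when the second argument is positive infinite; the other values are
irrelevant. -/

structure IsTransserialComposition (log : Series 𝔑 R → Series 𝔑 R)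
    (comp : Series 𝔑 R → Series 𝔑 R → Series 𝔑 R) : Prop where
  stronglyLinear : ∀ s, PosInf s → IsStronglyLinear (fun f => comp f s)
  map_one : ∀ s, PosInf s → comp 1 s = 1
  map_mul : ∀ s, PosInf s → ∀ f g, comp (f * g) s = comp f s * comp g s
  monotone : ∀ s, PosInf s → ∀ f g, f ≤ g → comp f s ≤ comp g s
  map_log : ∀ s, PosInf s → ∀ f, 0 < f → comp (log f) s = log (comp f s)
  assoc : ∀ s t, PosInf s → PosInf t → ∀ f, comp f (comp s t) = comp (comp f s) t

/-- `x` is an identity of the composition law `comp`. -/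
structure IsCompIdentity (comp : Series 𝔑 R → Series 𝔑 R → Series 𝔑 R)
    (x : Series 𝔑 R) : Prop where
  posInf : PosInf x
  id_comp : ∀ s, PosInf s → comp x s = s
  comp_id : ∀ f, comp f x = f

/-- Flatness of a composition law: every `n ∈ supp (m ∘ s)` can be written `n = d f v`, where `d` is
the dominant monomial of `m ∘ s`, the monomial `f` is strictly flatter than `m ∘ s`, and `v ≼ 1` is
flatter than some element of `supp s`. The monomial `m = 1` is left out, since nothing is strictly
flatter than `1 ∘ s = 1`. -/
def IsFlatComposition (log : Series 𝔑 R → Series 𝔑 R)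
    (comp : Series 𝔑 R → Series 𝔑 R → Series 𝔑 R) : Prop :=
  ∀ s, PosInf s → ∀ m : 𝔑, m ≠ 1 → ∀ n ∈ supp (comp (mono m) s),
    ∃ d f v : 𝔑, IsGreatest (supp (comp (mono m) s)) d ∧
      StrictlyFlatter log (mono f) (comp (mono m) s) ∧
      v ≤ 1 ∧ (∃ a ∈ supp s, Flatter (R := R) log (mono v) (mono a)) ∧ n = d * f * v

/-! ### Taylor expansions and the chain rule -/

def InTaylorConfiguration (D : Series 𝔑 R → Series 𝔑 R)
    (comp : Series 𝔑 R → Series 𝔑 R → Series 𝔑 R) (f s δ : Series 𝔑 R) : Prop :=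
  δ ≺ s ∧ ∀ m ∈ supp f, comp (D (mono m)) s * δ ≺ comp (mono m) s

/-- `f` has a Taylor expansion at `(s, δ)`. The last clause is the descending chain
`f ∘ s ≻ (f' ∘ s) δ ≻ (f'' ∘ s) δ² ≻ ⋯`, which may break off with zeros. -/
structure HasTaylorExpansion (D : Series 𝔑 R → Series 𝔑 R)
    (comp : Series 𝔑 R → Series 𝔑 R → Series 𝔑 R) (f s δ : Series 𝔑 R) : Prop where
  config : InTaylorConfiguration D comp f s δ
  summable : IsSummable (fun p : ↥(supp f) × ℕ => comp (D^[p.2] (mono p.1.1)) s * δ ^ p.2)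
  hasSum : HasStrongSum
    (fun k : ℕ => comp (D^[k] f) s / const (k.factorial : R) * δ ^ k) (comp f (s + δ))
  hasSum_mono : HasStrongSum
    (fun p : ↥(supp f) × ℕ => const (coeff f p.1.1) *
      (comp (D^[p.2] (mono p.1.1)) s / const (p.2.factorial : R) * δ ^ p.2)) (comp f (s + δ))
  descending : ∀ k : ℕ, comp (D^[k + 1] f) s * δ ^ (k + 1) ≠ 0 →
    comp (D^[k + 1] f) s * δ ^ (k + 1) ≺ comp (D^[k] f) s * δ ^ k

def HasTaylorExpansions (D : Series 𝔑 R → Series 𝔑 R)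
    (comp : Series 𝔑 R → Series 𝔑 R → Series 𝔑 R) : Prop :=
  ∀ f s δ, PosInf s → InTaylorConfiguration D comp f s δ → HasTaylorExpansion D comp f s δ

def SatisfiesChainRule (D : Series 𝔑 R → Series 𝔑 R)
    (comp : Series 𝔑 R → Series 𝔑 R → Series 𝔑 R) : Prop :=
  ∀ f s, PosInf s → D (comp f s) = D s * comp (D f) s

/-! ### Subfields of series and the group -/

/-- `R[[𝔐]]` as a subclass of `R[[𝔑]]`, for a subgroup `𝔐` of `𝔑`. -/
def seriesOver (R : Type w) [Field R] [LinearOrder R] [IsStrictOrderedRing R]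
    (𝔐 : Subgroup 𝔑) : Set (Series 𝔑 R) :=
  {s | supp s ⊆ 𝔐}

/-- The class of all `x + δ ∈ R[[𝔐]]` with `δ ≺ x`. -/
def tangentToIdentity (𝔐 : Subgroup 𝔑) (x : Series 𝔑 R) : Set (Series 𝔑 R) :=
  {s | s ∈ seriesOver R 𝔐 ∧ ∃ δ, δ ≺ x ∧ s = x + δ}

end Transserial

set_option linter.unusedSectionVars false

namespace Transserial

/-! ### Coefficients, dominant monomials and the dominance relation -/

section SeriesBasics

variable {𝔑 : Type (u + 1)} [CommGroup 𝔑] [LinearOrder 𝔑] [IsOrderedMonoid 𝔑]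
  {R : Type w} [Field R] [LinearOrder R] [IsStrictOrderedRing R]

/-! Only inverses are hard. Closure under `∘` follows from strong linearity, associativity is given,
and `f ↦ f ∘ s` is injective, so one-sided inverses are two-sided.

Suppose every monomial `n` of `y` satisfies `n' y ≺ n`. Taylor expansion then makes `f ↦ f ∘ (x +
y)` a contracting perturbation of the identity on a suitable space of series. So `θ ∘ (x + y) = -y`
has a solution, and `x + θ` inverts `x + y` (`exists_inverse_of_supp_subset_flatMonomials`). A
general `δ ≺ x` may contain monomials violating this condition.

The inverse is therefore built by induction along `supp δ`. Let `x + ε_m` invert the truncation of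
`x + δ` above `m`. By the mean value estimate `ε ∘ (x + η) - ε ≺ η` for `η ≠ 0`
(`val_lt_comp_id_add_sub`), later inverses differ from `ε_m` by at most the size of `m ∘ (x + ε_m)`
(`le_val_inverse_sub`), so there is a pseudo-limit `ε`. It satisfies `(x + δ) ∘ (x + ε) = x + y`
with `y ≼ m ∘ (x + ε_m)` for all `m ∈ supp δ` (`approx_inverse`). Flatness of `∘` shows that `y` is
of the first kind (`supp_comp_subset_flatMonomials`). If `x + θ` inverts `x + y`, then `(x + ε) ∘ (x
+ θ)` inverts `x + δ`. For this to work, the induction must also carry a bound on the logarithmic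
derivatives of the monomials of `ε_m`, recorded in `IsFlatInverse`. -/

theorem series_ext {s t : Series 𝔑 R} (h : ∀ m, coeff s m = coeff t m) : s = t := by
  apply Subtype.ext
  apply ofLex_inj.1
  ext m
  exact h (OrderDual.ofDual m).toMul

theorem coeff_zero (m : 𝔑) : coeff (0 : Series 𝔑 R) m = 0 := rfl

theorem coeff_add (s t : Series 𝔑 R) (m : 𝔑) : coeff (s + t) m = coeff s m + coeff t m := rfl

theorem coeff_neg (s : Series 𝔑 R) (m : 𝔑) : coeff (-s) m = -coeff s m := rfl

theorem coeff_sub (s t : Series 𝔑 R) (m : 𝔑) : coeff (s - t) m = coeff s m - coeff t m := rfl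

theorem coeff_const_mul (r : R) (s : Series 𝔑 R) (m : 𝔑) :
    coeff (const r * s) m = r * coeff s m := by
  change ((HahnSeries.single (0 : Expo 𝔑) r) * ofLex s.1).coeff _ = _
  rw [HahnSeries.single_zero_mul_eq_smul]
  rfl

theorem coeff_mono_self (m : 𝔑) : coeff (mono m : Series 𝔑 R) m = 1 := by
  change (HahnSeries.single _ (1 : R)).coeff _ = 1
  simp

theorem coeff_mono_of_ne {m n : 𝔑} (h : n ≠ m) : coeff (mono m : Series 𝔑 R) n = 0 := by
  change (HahnSeries.single _ (1 : R)).coeff _ = 0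
  rw [HahnSeries.coeff_single_of_ne]
  intro h'
  exact h (congrArg (fun a => (OrderDual.ofDual a).toMul) h')

theorem mem_supp_mono {m n : 𝔑} : n ∈ supp (mono m : Series 𝔑 R) ↔ n = m := by
  refine ⟨fun h => ?_, fun h => ?_⟩
  · by_contra h'
    exact h (coeff_mono_of_ne h')
  · subst h
    simp [supp, coeff_mono_self]

theorem mono_one : (mono 1 : Series 𝔑 R) = 1 := rfl

theorem const_one : (const 1 : Series 𝔑 R) = 1 := rfl

theorem const_zero : (const 0 : Series 𝔑 R) = 0 := by
  apply Subtype.ext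
  apply ofLex_inj.1
  change HahnSeries.single _ (0 : R) = 0
  simp

theorem coeff_const_mul_one (r : R) (m : 𝔑) :
    coeff (const r : Series 𝔑 R) m = r * coeff (1 : Series 𝔑 R) m := by
  rw [← coeff_const_mul, mul_one]

theorem const_add (a b : R) : (const (a + b) : Series 𝔑 R) = const a + const b :=
  series_ext fun m => by
    rw [coeff_add, coeff_const_mul_one, coeff_const_mul_one a, coeff_const_mul_one b, add_mul]

theorem mono_mul (m n : 𝔑) : (mono (m * n) : Series 𝔑 R) = mono m * mono n := by
  apply Subtype.ext
  apply ofLex_inj.1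
  change HahnSeries.single (OrderDual.toDual (Additive.ofMul (m * n)) : Expo 𝔑) (1 : R) =
    HahnSeries.single (OrderDual.toDual (Additive.ofMul m) : Expo 𝔑) 1 *
      HahnSeries.single (OrderDual.toDual (Additive.ofMul n) : Expo 𝔑) 1
  rw [HahnSeries.single_mul_single, one_mul]
  rfl

theorem mono_pos (m : 𝔑) : (0 : Series 𝔑 R) < mono m := by
  change (0 : Lex R⟦Expo 𝔑⟧) <
    toLex (HahnSeries.single (OrderDual.toDual (Additive.ofMul m) : Expo 𝔑) (1 : R))
  rw [← HahnSeries.leadingCoeff_pos_iff]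
  simp [zero_lt_one (α := R)]

theorem const_pos {r : R} (h : 0 < r) : (0 : Series 𝔑 R) < const r := by
  change (0 : Lex R⟦Expo 𝔑⟧) < toLex (HahnSeries.single (0 : Expo 𝔑) r)
  rw [← HahnSeries.leadingCoeff_pos_iff]
  simpa using h

theorem mono_ne_zero (m : 𝔑) : (mono m : Series 𝔑 R) ≠ 0 := (mono_pos m).ne'

/-- The exponent of a monomial. -/
def expo (m : 𝔑) : WithTop (Expo 𝔑) := ((OrderDual.toDual (Additive.ofMul m) : Expo 𝔑))

theorem expo_lt_expo {m n : 𝔑} : expo m < expo n ↔ n < m := by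
  rw [expo, expo, WithTop.coe_lt_coe]
  rfl

theorem expo_le_expo {m n : 𝔑} : expo m ≤ expo n ↔ n ≤ m := by
  rw [expo, expo, WithTop.coe_le_coe]
  rfl

theorem expo_lt_top (m : 𝔑) : expo m < ⊤ := WithTop.coe_lt_top _

/-- The valuation of a series: the exponent of its dominant monomial. -/
noncomputable def val (s : Series 𝔑 R) : WithTop (Expo 𝔑) := (ofLex s.1).orderTop

theorem val_eq_top {s : Series 𝔑 R} : val s = ⊤ ↔ s = 0 := by
  rw [val, HahnSeries.orderTop_eq_top]
  exact ⟨fun h => Subtype.ext (ofLex_inj.1 h), fun h => by rw [h]; rfl⟩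

theorem val_zero : val (0 : Series 𝔑 R) = ⊤ := val_eq_top.2 rfl

theorem val_mono (m : 𝔑) : val (mono m : Series 𝔑 R) = expo m :=
  HahnSeries.orderTop_single one_ne_zero

theorem val_const {r : R} (h : r ≠ 0) : val (const r : Series 𝔑 R) = 0 :=
  HahnSeries.orderTop_single h

theorem val_one : val (1 : Series 𝔑 R) = 0 := val_const one_ne_zero

theorem val_mul (s t : Series 𝔑 R) : val (s * t) = val s + val t :=
  HahnSeries.orderTop_mul _ _

theorem val_neg (s : Series 𝔑 R) : val (-s) = val s := HahnSeries.orderTop_neg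

theorem val_sub_comm (s t : Series 𝔑 R) : val (s - t) = val (t - s) := by
  rw [← val_neg, neg_sub]

theorem coe_abs (s : Series 𝔑 R) : (|s|).1 = |s.1| := by
  rcases le_total 0 s with h | h
  · rw [abs_of_nonneg h, abs_of_nonneg (show 0 ≤ s.1 from h)]
  · rw [abs_of_nonpos h, abs_of_nonpos (show s.1 ≤ 0 from h)]
    rfl

theorem val_abs (s : Series 𝔑 R) : val |s| = val s := by
  rw [val, coe_abs, HahnSeries.orderTop_abs, val]

theorem le_val_add {s t : Series 𝔑 R} {c : WithTop (Expo 𝔑)} (hs : c ≤ val s) (ht : c ≤ val t) :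
    c ≤ val (s + t) :=
  (le_min hs ht).trans HahnSeries.min_orderTop_le_orderTop_add

theorem le_val_sub {s t : Series 𝔑 R} {c : WithTop (Expo 𝔑)} (hs : c ≤ val s) (ht : c ≤ val t) :
    c ≤ val (s - t) :=
  (le_min hs ht).trans HahnSeries.min_orderTop_le_orderTop_sub

theorem lt_val_add {s t : Series 𝔑 R} {c : WithTop (Expo 𝔑)} (hs : c < val s) (ht : c < val t) :
    c < val (s + t) :=
  (lt_min hs ht).trans_le HahnSeries.min_orderTop_le_orderTop_add

theorem lt_val_sub {s t : Series 𝔑 R} {c : WithTop (Expo 𝔑)} (hs : c < val s) (ht : c < val t) :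
    c < val (s - t) :=
  (lt_min hs ht).trans_le HahnSeries.min_orderTop_le_orderTop_sub

theorem val_eq_of_lt_sub {s t : Series 𝔑 R} (h : val t < val (s - t)) : val s = val t := by
  have h1 : s = t + (s - t) := by ring
  rw [h1]
  exact HahnSeries.orderTop_add_eq_left h

theorem val_add_eq_left {s t : Series 𝔑 R} (h : val s < val t) : val (s + t) = val s :=
  HahnSeries.orderTop_add_eq_left h

theorem val_le_expo {s : Series 𝔑 R} {m : 𝔑} (h : m ∈ supp s) : val s ≤ expo m :=
  HahnSeries.orderTop_le_of_coeff_ne_zero h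

theorem coeff_eq_zero_of_lt_val {s : Series 𝔑 R} {m : 𝔑} (h : expo m < val s) : coeff s m = 0 :=
  HahnSeries.coeff_eq_zero_of_lt_orderTop h

theorem exists_mem_supp_val_eq {s : Series 𝔑 R} (h : s ≠ 0) : ∃ m ∈ supp s, val s = expo m := by
  have h1 : val s ≠ ⊤ := mt val_eq_top.1 h
  obtain ⟨g, hg⟩ := WithTop.ne_top_iff_exists.1 h1
  exact ⟨(OrderDual.ofDual g).toMul, HahnSeries.coeff_orderTop_ne hg.symm, hg.symm⟩

theorem le_val_of_forall_supp {s : Series 𝔑 R} {c : WithTop (Expo 𝔑)}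
    (h : ∀ m ∈ supp s, c ≤ expo m) : c ≤ val s := by
  by_cases h0 : s = 0
  · rw [h0, val_zero]; exact le_top
  · obtain ⟨m, hm, he⟩ := exists_mem_supp_val_eq h0
    rw [he]; exact h m hm

theorem val_eq_expo_of_isGreatest {s : Series 𝔑 R} {d : 𝔑} (h : IsGreatest (supp s) d) :
    val s = expo d :=
  le_antisymm (val_le_expo h.1) (le_val_of_forall_supp fun _ hm => expo_le_expo.2 (h.2 hm))

theorem supp_zero : supp (0 : Series 𝔑 R) = ∅ := by
  ext m; simp [supp, coeff_zero]

theorem supp_add_subset {s t : Series 𝔑 R} {A : Set 𝔑} (hs : supp s ⊆ A) (ht : supp t ⊆ A) :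
    supp (s + t) ⊆ A := by
  intro m hm
  by_contra hA
  have h1 : coeff s m = 0 := by by_contra h; exact hA (hs h)
  have h2 : coeff t m = 0 := by by_contra h; exact hA (ht h)
  exact hm (by rw [coeff_add, h1, h2, add_zero])

theorem supp_neg (s : Series 𝔑 R) : supp (-s) = supp s := by
  ext m; simp [supp, coeff_neg]

theorem supp_sub_subset {s t : Series 𝔑 R} {A : Set 𝔑} (hs : supp s ⊆ A) (ht : supp t ⊆ A) :
    supp (s - t) ⊆ A := by
  rw [sub_eq_add_neg]
  exact supp_add_subset hs (by rwa [supp_neg])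

theorem isWellBased_supp (s : Series 𝔑 R) : IsWellBased (supp s) := by
  constructor
  · have h := (mem_seriesSubfield_iff 𝔑 R s.1).1 s.2
    exact h
  · exact (ofLex s.1).isWF_support

/-- A coefficient function with well-based support is a series. -/
theorem exists_series (c : 𝔑 → R) (h : IsWellBased {m | c m ≠ 0}) :
    ∃ s : Series 𝔑 R, ∀ m, coeff s m = c m := by
  have hwf : (Function.support fun g : Expo 𝔑 => c (OrderDual.ofDual g).toMul).IsWF := h.2
  refine ⟨⟨toLex ⟨fun g => c (OrderDual.ofDual g).toMul, hwf.isPWO⟩, ?_⟩, fun m => rfl⟩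
  rw [mem_seriesSubfield_iff]
  exact h.1

/-! ### Dominance in terms of the valuation: larger valuation means smaller series. -/

theorem abs_lt_abs_of_val_lt {s t : Series 𝔑 R} (h : val t < val s) : |s| < |t| := by
  rw [← Subtype.coe_lt_coe, coe_abs, coe_abs]
  exact HahnSeries.abs_lt_abs_of_orderTop_ofLex h

theorem coeff_pos_iff {s : Series 𝔑 R} {m : 𝔑} (h : val s = expo m) : 0 < coeff s m ↔ 0 < s := by
  have h0 : (ofLex s.1) ≠ 0 := by
    intro h0
    have h1 : val s = ⊤ := by rw [val, h0, HahnSeries.orderTop_zero]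
    exact (expo_lt_top m).ne (h.symm.trans h1)
  rw [← Subtype.coe_lt_coe, ZeroMemClass.coe_zero, ← HahnSeries.leadingCoeff_pos_iff,
    ← HahnSeries.coeff_untop_eq_leadingCoeff (HahnSeries.orderTop_ne_top.2 h0), coeff]
  have h2 : (ofLex s.1).orderTop.untop (HahnSeries.orderTop_ne_top.2 h0) =
      OrderDual.toDual (Additive.ofMul m) := by
    rw [WithTop.untop_eq_iff]
    exact h
  rw [h2]

theorem prec_of_val_lt {s t : Series 𝔑 R} (h : val t < val s) : s ≺ t := by
  intro r hr
  have h1 : abs (const r * |s|) < |t| := by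
    apply abs_lt_abs_of_val_lt
    rwa [val_mul, val_const hr.ne', zero_add, val_abs]
  exact (le_abs_self _).trans_lt h1

theorem not_prec_of_val_eq {s t : Series 𝔑 R} (heq : val s = val t) : ¬ s ≺ t := by
  intro h
  by_cases hs : s = 0
  · have ht : t = 0 := val_eq_top.1 (by rw [← heq, hs, val_zero])
    have h1 := h 1 one_pos
    simp [hs, ht] at h1
  · obtain ⟨m, -, he⟩ := exists_mem_supp_val_eq hs
    have ht : t ≠ 0 := fun ht => hs (val_eq_top.1 (by rw [heq, ht, val_zero]))
    have es := (coeff_pos_iff ((val_abs s).trans he)).2 (abs_pos.2 hs)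
    have et := (coeff_pos_iff ((val_abs t).trans (heq.symm.trans he))).2 (abs_pos.2 ht)
    set a := coeff |s| m
    set b := coeff |t| m
    -- This scalar makes the leading coefficient of the difference equal to `b - (b + 1) = -1`,
    -- against positivity.
    have h1 := sub_pos.2 (h ((b + 1) / a) (by positivity))
    have hd : coeff (|t| - const ((b + 1) / a) * |s|) m = -1 := by
      rw [coeff_sub, coeff_const_mul]
      change b - (b + 1) / a * a = -1
      field_simp; ring
    have hv : val (|t| - const ((b + 1) / a) * |s|) = expo m := by
      apply le_antisymm
      · apply val_le_expo
        change _ ≠ 0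
        rw [hd]; simp
      · apply le_val_sub
        · rw [val_abs, ← heq, he]
        · rw [val_mul, val_const (by positivity), zero_add, val_abs, he]
    have h3 := (coeff_pos_iff hv).2 h1
    rw [hd] at h3
    linarith [zero_lt_one (α := R)]

theorem prec_iff {s t : Series 𝔑 R} : s ≺ t ↔ val t < val s := by
  refine ⟨fun h => ?_, prec_of_val_lt⟩
  by_contra hv
  rcases (not_lt.1 hv).lt_or_eq with hlt | heq
  · have h1 := h 1 one_pos
    rw [const_one, one_mul] at h1
    exact lt_asymm h1 (abs_lt_abs_of_val_lt hlt)
  · exact not_prec_of_val_eq heq h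

theorem precEq_iff {s t : Series 𝔑 R} : s ≼ t ↔ val t ≤ val s := by
  rw [PrecEq, prec_iff, not_lt]

theorem exists_abs_le_of_val_le {s t : Series 𝔑 R} (h : val t ≤ val s) :
    ∃ r : R, 0 < r ∧ |s| ≤ const r * |t| := by
  have h1 := precEq_iff.2 h
  rw [PrecEq, Prec] at h1
  push Not at h1
  exact h1

theorem posInf_of_pos {s : Series 𝔑 R} (h0 : 0 < s) (h : val s < 0) : PosInf s := by
  intro r
  by_cases hr : r = 0
  · rw [hr, const_zero]; exact h0
  · have := abs_lt_abs_of_val_lt (s := const r) (t := s) (by rwa [val_const hr])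
    rw [abs_of_pos h0] at this
    exact (le_abs_self _).trans_lt this

theorem PosInf.pos {s : Series 𝔑 R} (h : PosInf s) : 0 < s := by
  have := h 0
  rwa [const_zero] at this

theorem PosInf.val_lt {s : Series 𝔑 R} (h : PosInf s) : val s < 0 := by
  rw [← val_one (𝔑 := 𝔑) (R := R), ← prec_iff]
  intro r _
  rw [abs_one, mul_one, abs_of_pos h.pos]
  exact h r

theorem pos_of_val_lt_sub {s t : Series 𝔑 R} (ht : 0 < t) (h : val t < val (s - t)) : 0 < s := by
  have h1 := abs_lt_abs_of_val_lt h
  rw [abs_of_pos ht] at h1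
  have := neg_abs_le (s - t)
  linarith

theorem PosInf.add {s t : Series 𝔑 R} (h : PosInf s) (ht : val s < val t) : PosInf (s + t) :=
  posInf_of_pos (pos_of_val_lt_sub h.pos (by rwa [add_sub_cancel_left]))
    (by rw [val_add_eq_left ht]; exact h.val_lt)

end SeriesBasics

/-! ### Truncations, limits and strongly linear maps -/

section Limits

variable {𝔑 : Type (u + 1)} [CommGroup 𝔑] [LinearOrder 𝔑] [IsOrderedMonoid 𝔑]
  {R : Type w} [Field R] [LinearOrder R] [IsStrictOrderedRing R]

theorem IsWellBased.mono {A B : Set 𝔑} (hB : IsWellBased B) (h : A ⊆ B) : IsWellBased A :=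
  ⟨@small_subset _ _ _ h hB.1, hB.2.subset h⟩

theorem exists_trunc (s : Series 𝔑 R) (m : 𝔑) :
    ∃ t : Series 𝔑 R, ∀ n, coeff t n = if m < n then coeff s n else 0 := by
  apply exists_series
  apply (isWellBased_supp s).mono
  intro n hn
  by_contra h
  have h0 : coeff s n = 0 := not_not.1 h
  exact hn (by rw [h0, ite_self])

/-- The truncation of a series to its monomials above `m`. -/
noncomputable def trunc (s : Series 𝔑 R) (m : 𝔑) : Series 𝔑 R := (exists_trunc s m).choose

theorem coeff_trunc (s : Series 𝔑 R) (m n : 𝔑) :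
    coeff (trunc s m) n = if m < n then coeff s n else 0 := (exists_trunc s m).choose_spec n

theorem mem_supp_trunc {s : Series 𝔑 R} {m n : 𝔑} :
    n ∈ supp (trunc s m) ↔ n ∈ supp s ∧ m < n := by
  rw [supp, supp]
  change coeff (trunc s m) n ≠ 0 ↔ coeff s n ≠ 0 ∧ m < n
  rw [coeff_trunc]
  split_ifs with h <;> simp [h]

theorem trunc_trunc {s : Series 𝔑 R} {m n : 𝔑} (h : m ≤ n) :
    trunc (trunc s m) n = trunc s n := by
  refine series_ext fun k => ?_
  rw [coeff_trunc, coeff_trunc, coeff_trunc]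
  by_cases h1 : n < k
  · rw [if_pos h1, if_pos h1, if_pos (h.trans_lt h1)]
  · rw [if_neg h1, if_neg h1]

theorem expo_le_val_sub_trunc (s : Series 𝔑 R) (m : 𝔑) : expo m ≤ val (s - trunc s m) := by
  apply le_val_of_forall_supp
  intro n hn
  rw [expo_le_expo]
  by_contra h
  apply hn
  rw [coeff_sub, coeff_trunc, if_pos (not_le.1 h), sub_self]

theorem le_val_trunc {s : Series 𝔑 R} (m : 𝔑) : val s ≤ val (trunc s m) :=
  le_val_of_forall_supp fun _ hn => val_le_expo (mem_supp_trunc.1 hn).1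

/-- Families that are Cauchy with respect to given error bounds have a limit whose support is
contained in the union of their supports. -/
theorem exists_pseudoLimit {ι : Type*} (a : ι → Series 𝔑 R) (b : ι → WithTop (Expo 𝔑))
    (h : ∀ i j, b i ≤ val (a j - a i) ∨ b j ≤ val (a j - a i))
    (hs : Small.{u} ↥(⋃ i, supp (a i))) :
    ∃ l : Series 𝔑 R, supp l ⊆ ⋃ i, supp (a i) ∧ ∀ i, b i ≤ val (l - a i) := by
  classical
  -- The coefficient at `n` is read off from any member whose error lies strictly below `n`; the
  -- Cauchy condition makes the choice immaterial. It is `0` if there is no such member.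
  let c : 𝔑 → R := fun n => if hn : ∃ i, expo n < b i then coeff (a hn.choose) n else 0
  have hc : ∀ n i, expo n < b i → c n = coeff (a i) n := by
    intro n i hi
    have hn : ∃ i, expo n < b i := ⟨i, hi⟩
    have h1 : c n = coeff (a hn.choose) n := dif_pos hn
    rw [h1, ← sub_eq_zero, ← coeff_sub]
    apply coeff_eq_zero_of_lt_val
    rcases h i hn.choose with h2 | h2
    · exact hi.trans_le h2
    · exact hn.choose_spec.trans_le h2
  have hex : ∀ n, c n ≠ 0 → ∃ i, expo n < b i := by
    intro n hn
    by_contra h'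
    exact hn (dif_neg h')
  have hsub : {n | c n ≠ 0} ⊆ ⋃ i, supp (a i) := by
    intro n hn
    obtain ⟨i, hi⟩ := hex n hn
    refine Set.mem_iUnion.2 ⟨i, ?_⟩
    change coeff (a i) n ≠ 0
    rw [← hc n i hi]
    exact hn
  have hwb : IsWellBased {n | c n ≠ 0} := by
    refine ⟨@small_subset _ _ _ hsub hs, ?_⟩
    -- A strictly increasing sequence of monomials stays above its first term, hence above the error
    -- of a single `a i`, and so would lie in the well-based `supp (a i)`.
    rw [Set.wellFoundedOn_iff_no_descending_seq]
    intro f hf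
    obtain ⟨i, hi⟩ := hex (f 0) (hf 0)
    have hlt : ∀ k, expo (f k) < b i := fun k =>
      lt_of_le_of_lt (expo_le_expo.2 (by
        rcases Nat.eq_zero_or_pos k with rfl | hk
        · exact le_rfl
        · exact (f.map_rel_iff.2 hk).le)) hi
    have hmem : ∀ k, f k ∈ supp (a i) := by
      intro k
      change coeff (a i) (f k) ≠ 0
      rw [← hc _ i (hlt k)]
      exact hf k
    exact Set.wellFoundedOn_iff_no_descending_seq.1 (isWellBased_supp (a i)).2 f hmem
  obtain ⟨l, hl⟩ := exists_series c hwb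
  refine ⟨l, ?_, fun i => ?_⟩
  · intro n hn
    exact hsub (by change c n ≠ 0; rw [← hl]; exact hn)
  · apply le_val_of_forall_supp
    intro n hn
    by_contra hlt
    apply hn
    rw [coeff_sub, hl, hc n i (not_le.1 hlt), sub_self]

/-- An additive perturbation of the identity by a contracting map is surjective on the series with
support in a set. -/
theorem exists_eq_of_contracting {X : Set 𝔑} (hX : Small.{u} X) (Φ : Series 𝔑 R → Series 𝔑 R)
    (hadd : ∀ s t, Φ (s - t) = Φ s - Φ t) (hmaps : ∀ s, supp s ⊆ X → supp (Φ s) ⊆ X)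
    (hcon : ∀ s, supp s ⊆ X → s ≠ 0 → val s < val (Φ s - s)) (g : Series 𝔑 R)
    (hg : supp g ⊆ X) : ∃ s, supp s ⊆ X ∧ Φ s = g := by
  let V := {s : Series 𝔑 R // supp s ⊆ X}
  -- `t` refines `s`: it differs from `s` by at most the residual of `s`, and its own residual is no
  -- larger.
  let r : V → V → Prop := fun s t =>
    val (g - Φ s.1) ≤ val (t.1 - s.1) ∧ val (g - Φ s.1) ≤ val (g - Φ t.1)
  have hval : ∀ s, supp s ⊆ X → val s ≤ val (Φ s) := by
    intro s hs
    by_cases h0 : s = 0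
    · subst h0
      have h1 := hadd 0 0
      rw [sub_self, sub_self] at h1
      rw [h1]
    · exact (val_eq_of_lt_sub (hcon s hs h0)).ge
  obtain ⟨m, hm⟩ := exists_maximal_of_chains_bounded (r := r) (by
    intro c hc
    -- The chain may be a proper class; the limit still has small support because all supports lie
    -- in `X`.
    obtain ⟨l, hl, hli⟩ := exists_pseudoLimit (fun s : c => s.1.1)
      (fun s : c => val (g - Φ s.1.1)) (by
        intro i j
        by_cases hij : i = j
        · left
          rw [hij, sub_self, val_zero]
          exact le_top
        · rcases hc i.2 j.2 (fun h => hij (Subtype.ext h)) with h | h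
          · exact Or.inl h.1
          · right
            rw [val_sub_comm j.1.1]
            exact h.1)
      (small_subset (Set.iUnion_subset fun i : c => i.1.2))
    have hlX : supp l ⊆ X := hl.trans (Set.iUnion_subset fun i : c => i.1.2)
    refine ⟨⟨l, hlX⟩, fun s hs => ⟨hli ⟨s, hs⟩, ?_⟩⟩
    have h1 : g - Φ l = (g - Φ s.1) - Φ (l - s.1) := by rw [hadd]; ring
    change _ ≤ val (g - Φ l)
    rw [h1]
    exact le_val_sub le_rfl ((hli ⟨s, hs⟩).trans (hval _ (supp_sub_subset hlX s.2)))) (by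
    intro a b c hab hbc
    refine ⟨?_, hab.2.trans hbc.2⟩
    have h1 : c.1 - a.1 = (c.1 - b.1) + (b.1 - a.1) := by ring
    rw [h1]
    exact le_val_add (hab.2.trans hbc.1) hab.1)
  refine ⟨m.1, m.2, ?_⟩
  by_contra hne
  -- Adding the residual `e` to the maximal element leaves the residual `e - Φ e ≺ e`, a strict
  -- improvement.
  set e := g - Φ m.1 with he
  have he0 : e ≠ 0 := sub_ne_zero.2 (Ne.symm hne)
  have heX : supp e ⊆ X := supp_sub_subset hg (hmaps _ m.2)
  have hnX : supp (m.1 + e) ⊆ X := supp_add_subset m.2 heX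
  have h2 : g - Φ (m.1 + e) = -(Φ e - e) := by
    have h3 : Φ e = Φ (m.1 + e) - Φ m.1 := by rw [← hadd, add_sub_cancel_left]
    rw [h3, he]; ring
  have h4 : val e < val (g - Φ (m.1 + e)) := by
    rw [h2, val_neg]
    exact hcon e heX he0
  have h5 := (hm ⟨m.1 + e, hnX⟩ ⟨by
    change val e ≤ val (m.1 + e - m.1)
    rw [add_sub_cancel_left], h4.le⟩).2
  exact absurd h5 (not_le.2 h4)

/-- A small set of monomials generates a small set under an operation with small values. -/
theorem exists_small_closure {X H : Set 𝔑} (hX : Small.{u} X) (hXH : X ⊆ H) (F : 𝔑 → Set 𝔑)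
    (hF : ∀ n, Small.{u} (F n)) (hFH : ∀ n ∈ H, F n ⊆ H) :
    ∃ Y : Set 𝔑, Small.{u} Y ∧ X ⊆ Y ∧ Y ⊆ H ∧ ∀ n ∈ Y, F n ⊆ Y := by
  let Z : ℕ → Set 𝔑 := fun k => Nat.rec X (fun _ A => ⋃ n : ↥A, F n.1) k
  have hZsucc : ∀ k, Z (k + 1) = ⋃ n : ↥(Z k), F n.1 := fun k => rfl
  have hZs : ∀ k, Small.{u} ↥(Z k) := by
    intro k
    induction k with
    | zero => exact hX
    | succ k ih =>
      rw [hZsucc]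
      exact @small_iUnion _ _ ih _ fun n => hF n.1
  have hZH : ∀ k, Z k ⊆ H := by
    intro k
    induction k with
    | zero => exact hXH
    | succ k ih =>
      rw [hZsucc]
      exact Set.iUnion_subset fun n => hFH n.1 (ih n.2)
  refine ⟨⋃ k, Z k, @small_iUnion _ _ inferInstance Z hZs, Set.subset_iUnion Z 0, Set.iUnion_subset hZH, ?_⟩
  intro n hn p hp
  obtain ⟨k, hk⟩ := Set.mem_iUnion.1 hn
  refine Set.mem_iUnion.2 ⟨k + 1, ?_⟩
  rw [hZsucc]
  exact Set.mem_iUnion.2 ⟨⟨n, hk⟩, hp⟩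

/-! ### Strongly linear maps, computed monomial by monomial. -/

theorem hasStrongSum_terms (f : Series 𝔑 R) :
    HasStrongSum (fun n : supp f => const (coeff f n.1) * mono n.1) f := by
  have hc : ∀ (n : supp f) m, coeff (const (coeff f n.1) * mono n.1) m =
      if m = n.1 then coeff f m else 0 := by
    intro n m
    rw [coeff_const_mul]
    split_ifs with h
    · rw [h, coeff_mono_self, mul_one]
    · rw [coeff_mono_of_ne h, mul_zero]
  have hmem : ∀ (n : supp f) m, m ∈ supp (const (coeff f n.1) * mono n.1) → m = n.1 := by
    intro n m hm
    by_contra h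
    exact hm (by rw [hc, if_neg h])
  refine ⟨⟨(isWellBased_supp f).mono ?_, fun m => ?_⟩, fun m => ?_⟩
  · refine Set.iUnion_subset fun n m hm => ?_
    rw [hmem n m hm]
    exact n.2
  · apply Set.Subsingleton.finite
    intro i hi j hj
    exact Subtype.ext ((hmem i m hi).symm.trans (hmem j m hj))
  · by_cases h : m ∈ supp f
    · rw [finsum_eq_single _ ⟨m, h⟩]
      · rw [hc, if_pos rfl]
      · intro n hn
        rw [hc, if_neg]
        intro h'
        exact hn (Subtype.ext h'.symm)
    · have h0 : coeff f m = 0 := not_not.1 h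
      rw [h0]
      refine (finsum_eq_zero_of_forall_eq_zero fun n => ?_).symm
      rw [hc, h0, ite_self]

theorem IsStronglyLinear.coeff_eq {Φ : Series 𝔑 R → Series 𝔑 R} (hΦ : IsStronglyLinear Φ)
    (f : Series 𝔑 R) (m : 𝔑) :
    coeff (Φ f) m = ∑ᶠ n : supp f, coeff f n.1 * coeff (Φ (mono n.1)) m := by
  rw [(hΦ.map_sum _ _ _ (hasStrongSum_terms f)).2 m]
  refine finsum_congr fun n => ?_
  dsimp only
  rw [hΦ.map_const_mul, coeff_const_mul]

theorem IsStronglyLinear.supp_finite {Φ : Series 𝔑 R → Series 𝔑 R} (hΦ : IsStronglyLinear Φ)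
    (f : Series 𝔑 R) (m : 𝔑) :
    (Function.support fun n : supp f => coeff f n.1 * coeff (Φ (mono n.1)) m).Finite := by
  refine ((hΦ.map_sum _ _ _ (hasStrongSum_terms f)).1.2 m).subset fun n hn => ?_
  change coeff _ m ≠ 0
  dsimp only
  rw [hΦ.map_const_mul, coeff_const_mul]
  exact hn

theorem IsStronglyLinear.supp_subset {Φ : Series 𝔑 R → Series 𝔑 R} (hΦ : IsStronglyLinear Φ)
    {f : Series 𝔑 R} {A : Set 𝔑} (h : ∀ n ∈ supp f, supp (Φ (mono n)) ⊆ A) :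
    supp (Φ f) ⊆ A := by
  intro m hm
  by_contra hA
  apply hm
  rw [hΦ.coeff_eq]
  refine finsum_eq_zero_of_forall_eq_zero fun n => ?_
  have : coeff (Φ (mono n.1)) m = 0 := by
    by_contra h0
    exact hA (h n.1 n.2 h0)
  rw [this, mul_zero]

theorem isStronglyLinear_id : IsStronglyLinear (fun s : Series 𝔑 R => s) :=
  ⟨fun _ _ => rfl, fun _ _ => rfl, fun _ _ _ h => h⟩

/-- Passes from Taylor estimates on single monomials to estimates on whole series. -/
theorem IsStronglyLinear.supp_sub_subset {Φ : Series 𝔑 R → Series 𝔑 R} (hΦ : IsStronglyLinear Φ)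
    {f : Series 𝔑 R} {A : Set 𝔑} (h : ∀ n ∈ supp f, supp (Φ (mono n) - mono n) ⊆ A) :
    supp (Φ f - f) ⊆ A := by
  intro m hm
  by_contra hA
  apply hm
  have h1 := isStronglyLinear_id.coeff_eq f m
  rw [coeff_sub, hΦ.coeff_eq, h1,
    ← finsum_sub_distrib (hΦ.supp_finite f m) (isStronglyLinear_id.supp_finite f m)]
  refine finsum_eq_zero_of_forall_eq_zero fun n => ?_
  have : coeff (Φ (mono n.1) - mono n.1) m = 0 := by
    by_contra h0
    exact hA (h n.1 n.2 h0)
  rw [← mul_sub, ← coeff_sub, this, mul_zero]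

theorem IsStronglyLinear.map_sub {Φ : Series 𝔑 R → Series 𝔑 R} (hΦ : IsStronglyLinear Φ)
    (s t : Series 𝔑 R) : Φ (s - t) = Φ s - Φ t := by
  rw [eq_sub_iff_add_eq, ← hΦ.map_add, sub_add_cancel]

theorem IsStronglyLinear.map_zero {Φ : Series 𝔑 R → Series 𝔑 R} (hΦ : IsStronglyLinear Φ) :
    Φ 0 = 0 := by
  have h := hΦ.map_sub 0 0
  rwa [sub_self, sub_self] at h

theorem IsStronglyLinear.map_neg {Φ : Series 𝔑 R → Series 𝔑 R} (hΦ : IsStronglyLinear Φ)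
    (s : Series 𝔑 R) : Φ (-s) = -Φ s := by
  rw [← zero_sub, hΦ.map_sub, hΦ.map_zero, zero_sub]

end Limits

/-! ### Derivations, flatness and Taylor estimates around the identity -/

section Flat

variable {𝔑 : Type (u + 1)} [CommGroup 𝔑] [LinearOrder 𝔑] [IsOrderedMonoid 𝔑]
  {R : Type w} [Field R] [LinearOrder R] [IsStrictOrderedRing R]

theorem val_ne_top {s : Series 𝔑 R} (hs : s ≠ 0) : val s ≠ ⊤ := mt val_eq_top.1 hs

theorem expo_mul (m n : 𝔑) : expo (m * n) = expo m + expo n := rfl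

theorem mono_ne_one {n : 𝔑} (hn : n ≠ 1) : (mono n : Series 𝔑 R) ≠ 1 := by
  intro h
  have h1 : n ∈ supp (mono n : Series 𝔑 R) := mem_supp_mono.2 rfl
  rw [h, ← mono_one] at h1
  exact hn (mem_supp_mono.1 h1)

/-- A transserial H-field with a flat composition law and Taylor expansions, whose identity is a
monomial. -/
structure IsFlatComposable (log D : Series 𝔑 R → Series 𝔑 R)
    (comp : Series 𝔑 R → Series 𝔑 R → Series 𝔑 R) (x : Series 𝔑 R) : Prop where
  transserial : IsTransserialField log
  deriv : IsTransserialDerivation log D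
  hField : IsHField D
  deriv_id : D x = 1
  composition : IsTransserialComposition log comp
  compId : IsCompIdentity comp x
  flat : IsFlatComposition log comp
  taylor : HasTaylorExpansions D comp
  exists_mono : ∃ m : 𝔑, mono m = x

/-- The monomials `n` with `n' z ≺ n`, for any `z` of valuation `c`. -/
def flatMonomials (D : Series 𝔑 R → Series 𝔑 R) (c : WithTop (Expo 𝔑)) : Set 𝔑 :=
  {n | expo n < val (D (mono n)) + c}

theorem flatMonomials_mono (D : Series 𝔑 R → Series 𝔑 R) {c c' : WithTop (Expo 𝔑)} (h : c ≤ c') :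
    flatMonomials D c ⊆ flatMonomials D c' :=
  fun _ hn => lt_of_lt_of_le hn (add_le_add_right h _)

namespace IsFlatComposable

variable {log D : Series 𝔑 R → Series 𝔑 R} {comp : Series 𝔑 R → Series 𝔑 R → Series 𝔑 R}
  {x : Series 𝔑 R} (T : IsFlatComposable log D comp x)

include T

/-! ### H-field asymptotics and logarithmic derivatives. -/

theorem deriv_const (r : R) : D (const r) = 0 := (T.hField.ker _).2 ⟨r, rfl⟩

theorem deriv_one : D 1 = 0 := T.deriv_const 1

theorem val_deriv_neg (s : Series 𝔑 R) : val (D (-s)) = val (D s) := by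
  rw [T.deriv.stronglyLinear.map_neg, val_neg]

theorem val_deriv_abs (s : Series 𝔑 R) : val (D |s|) = val (D s) := by
  rcases abs_choice s with h | h <;> rw [h]
  exact T.val_deriv_neg s

/-- For infinite `b` and `a ≺ b`, the series `|b| - r|a|` is positive infinite for every `r` of
either sign, so its derivative is positive. -/
theorem val_deriv_lt {a b : Series 𝔑 R} (hb : val b < 0) (hab : val b < val a) :
    val (D b) < val (D a) := by
  rw [← T.val_deriv_abs b, ← T.val_deriv_abs a, ← prec_iff]
  have hpos : ∀ r : R, 0 < D |b| - const r * D |a| := by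
    intro r
    have h1 : PosInf (|b| - const r * |a|) := by
      by_cases hr : r = 0
      · rw [hr, const_zero, zero_mul, sub_zero]
        refine posInf_of_pos (abs_pos.2 ?_) (by rwa [val_abs])
        rintro rfl
        rw [val_zero] at hb
        exact absurd hb (not_lt.2 le_top)
      · have h2 : val |b| < val (-(const r * |a|)) := by
          rwa [val_neg, val_mul, val_const hr, zero_add, val_abs, val_abs]
        rw [sub_eq_add_neg]
        refine PosInf.add (posInf_of_pos (abs_pos.2 ?_) (by rwa [val_abs])) h2
        rintro rfl
        rw [val_zero] at hb
        exact absurd hb (not_lt.2 le_top)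
    have h3 := T.hField.deriv_pos _ h1
    rwa [T.deriv.stronglyLinear.map_sub, T.deriv.stronglyLinear.map_const_mul] at h3
  intro r hr
  have hc : (const (-r) : Series 𝔑 R) = -const r := by
    have := const_add (𝔑 := 𝔑) r (-r)
    rw [add_neg_cancel, const_zero] at this
    exact (neg_eq_of_add_eq_zero_right this.symm).symm
  have h0 := hpos 0
  rw [const_zero, zero_mul, sub_zero] at h0
  rw [abs_of_pos h0]
  rcases abs_choice (D |a|) with h | h <;> rw [h]
  · exact sub_pos.1 (hpos r)
  · have := sub_pos.1 (hpos (-r))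
    rw [hc] at this
    linarith

/-- If `|a| ≤ r|b|`, then `(r + 1)|b| ± a` exceeds the positive infinite `|b|`, so both signs have
positive derivative and `|a'| < (r + 1)|b|'`. -/
theorem val_deriv_le {a b : Series 𝔑 R} (hb : val b < 0) (hab : val b ≤ val a) :
    val (D b) ≤ val (D a) := by
  obtain ⟨r, hr, hle⟩ := exists_abs_le_of_val_le hab
  rw [← T.val_deriv_abs b]
  have hb0 : b ≠ 0 := by
    rintro rfl
    rw [val_zero] at hb
    exact absurd hb (not_lt.2 le_top)
  have hpos : ∀ a' : Series 𝔑 R, a' ≤ |a| → 0 < const (r + 1) * D |b| - D a' := by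
    intro a' ha'
    have h1 : PosInf (const (r + 1) * |b| - a') := by
      intro q
      have h2 := posInf_of_pos (abs_pos.2 hb0) (by rwa [val_abs]) q
      rw [const_add, const_one]
      linarith
    have h3 := T.hField.deriv_pos _ h1
    rwa [T.deriv.stronglyLinear.map_sub, T.deriv.stronglyLinear.map_const_mul] at h3
  by_contra hlt
  rw [not_le, ← prec_iff] at hlt
  have h1 := hlt (r + 1) (by linarith)
  have h2 : const (r + 1) * D |b| ≤ const (r + 1) * abs (D |b|) :=
    mul_le_mul_of_nonneg_left (le_abs_self _) (const_pos (by linarith)).le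
  have h3 := hpos a (le_abs_self _)
  have h4 := hpos (-a) (neg_le_abs _)
  rw [T.deriv.stronglyLinear.map_neg] at h4
  rcases abs_choice (D a) with h | h <;> rw [h] at h1 <;> linarith

theorem val_id_neg : val x < 0 := T.compId.posInf.val_lt

theorem val_deriv_pos {a : Series 𝔑 R} (h : val x < val a) : 0 < val (D a) := by
  have := T.val_deriv_lt T.val_id_neg h
  rwa [T.deriv_id, val_one] at this

theorem val_deriv_eq {s : Series 𝔑 R} (hs : s ≠ 0) :
    val (D s) = val (D (log |s|)) + val s := by
  rw [T.deriv.map_log s hs, ← val_mul, div_mul_cancel₀ _ hs]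

/-- The condition `s' z ≺ s` says that the logarithmic derivative of `s` times `z` is infinitesimal,
which is what makes it comparable with flatness. -/
theorem lt_val_deriv_add_iff {s : Series 𝔑 R} (hs : s ≠ 0) {c : WithTop (Expo 𝔑)} :
    val s < val (D s) + c ↔ 0 < val (D (log |s|)) + c := by
  rw [T.val_deriv_eq hs, add_right_comm]
  conv_lhs => lhs; rw [← zero_add (val s)]
  exact WithTop.add_lt_add_iff_right (val_ne_top hs)

theorem mem_flatMonomials_iff {n : 𝔑} {c : WithTop (Expo 𝔑)} :
    n ∈ flatMonomials D c ↔ 0 < val (D (log |(mono n : Series 𝔑 R)|)) + c := by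
  rw [← T.lt_val_deriv_add_iff (mono_ne_zero n), val_mono]
  rfl

theorem one_mem_flatMonomials (c : WithTop (Expo 𝔑)) : (1 : 𝔑) ∈ flatMonomials D c := by
  change expo 1 < val (D (mono 1)) + c
  rw [mono_one, T.deriv_one, val_zero, WithTop.top_add]
  exact expo_lt_top 1

theorem mul_mem_flatMonomials {m n : 𝔑} {c : WithTop (Expo 𝔑)} (hm : m ∈ flatMonomials D c)
    (hn : n ∈ flatMonomials D c) : m * n ∈ flatMonomials D c := by
  have h1 : val (D (mono m) * mono n + mono m * D (mono n)) ≤ val (D (mono (m * n))) := by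
    rw [mono_mul, T.deriv.leibniz]
  refine lt_of_lt_of_le ?_ (add_le_add_left h1 c)
  rcases min_choice (val (D (mono m) * mono n)) (val (mono m * D (mono n))) with h | h
  all_goals
    refine lt_of_lt_of_le ?_ (add_le_add_left HahnSeries.min_orderTop_le_orderTop_add c)
    change _ < min (val (D (mono m) * mono n)) (val (mono m * D (mono n))) + c
    rw [h, val_mul, val_mono, expo_mul]
  · rw [add_right_comm]
    exact (WithTop.add_lt_add_iff_right (expo_lt_top n).ne).2 hm
  · rw [add_assoc]
    exact (WithTop.add_lt_add_iff_left (expo_lt_top m).ne).2 hn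

/-- Here `n ≺ x` gives `n' ≺ 1`, so `n' z ≼ n' n ≺ n` whenever `z ≼ n`. -/
theorem mem_flatMonomials_of_le {n : 𝔑} {c : WithTop (Expo 𝔑)} (hn : val x < expo n)
    (hc : expo n ≤ c) : n ∈ flatMonomials D c := by
  have h := T.val_deriv_pos (a := mono n) (by rwa [val_mono])
  refine lt_of_lt_of_le ?_ (add_le_add_right hc _)
  conv_lhs => rw [← zero_add (expo n)]
  exact (WithTop.add_lt_add_iff_right (expo_lt_top n).ne).2 h

/-! Composition with a fixed positive infinite series. -/

section Comp

variable {s : Series 𝔑 R} (hs : PosInf s)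

include hs

theorem comp_const (r : R) : comp (const r) s = const r := by
  have := (T.composition.stronglyLinear s hs).map_const_mul r 1
  simp only [mul_one, T.composition.map_one s hs] at this
  exact this

theorem comp_sub (f g : Series 𝔑 R) : comp (f - g) s = comp f s - comp g s :=
  (T.composition.stronglyLinear s hs).map_sub f g

theorem comp_add (f g : Series 𝔑 R) : comp (f + g) s = comp f s + comp g s :=
  (T.composition.stronglyLinear s hs).map_add f g

theorem comp_zero : comp 0 s = 0 := (T.composition.stronglyLinear s hs).map_zero

theorem comp_ne_zero {f : Series 𝔑 R} (hf : f ≠ 0) : comp f s ≠ 0 := by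
  intro h
  have h1 := T.composition.map_mul s hs f f⁻¹
  rw [mul_inv_cancel₀ hf, T.composition.map_one s hs, h, zero_mul] at h1
  exact one_ne_zero h1

theorem comp_injective {f g : Series 𝔑 R} (h : comp f s = comp g s) : f = g := by
  by_contra hne
  exact T.comp_ne_zero hs (sub_ne_zero.2 hne) (by rw [T.comp_sub hs, h, sub_self])

theorem comp_lt {f g : Series 𝔑 R} (h : f < g) : comp f s < comp g s :=
  lt_of_le_of_ne (T.composition.monotone s hs f g h.le) fun he => h.ne (T.comp_injective hs he)

theorem comp_pos {f : Series 𝔑 R} (h : 0 < f) : 0 < comp f s := by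
  have := T.comp_lt hs h
  rwa [T.comp_zero hs] at this

theorem comp_abs (f : Series 𝔑 R) : comp |f| s = |comp f s| := by
  have h0 : 0 ≤ comp |f| s := by
    have := T.composition.monotone s hs 0 |f| (abs_nonneg f)
    rwa [T.comp_zero hs] at this
  rw [← abs_of_nonneg h0]
  rcases abs_choice f with h | h <;> rw [h]
  rw [(T.composition.stronglyLinear s hs).map_neg, abs_neg]

theorem val_comp_lt {f g : Series 𝔑 R} (h : val f < val g) : val (comp f s) < val (comp g s) := by
  rw [← prec_iff] at h ⊢
  intro r hr
  have := T.comp_lt hs (h r hr)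
  rwa [T.composition.map_mul s hs, T.comp_const hs, T.comp_abs hs, T.comp_abs hs] at this

theorem val_comp_le {f g : Series 𝔑 R} (h : val f ≤ val g) : val (comp f s) ≤ val (comp g s) := by
  obtain ⟨r, hr, hle⟩ := exists_abs_le_of_val_le h
  have h1 := T.composition.monotone s hs _ _ hle
  rw [T.composition.map_mul s hs, T.comp_const hs, T.comp_abs hs, T.comp_abs hs] at h1
  by_contra hlt
  rw [not_le, ← prec_iff] at hlt
  exact absurd (hlt r hr) (not_lt.2 h1)

end Comp

theorem posInf_id_add {η : Series 𝔑 R} (h : val x < val η) : PosInf (x + η) :=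
  T.compId.posInf.add h

/-! ### First-order Taylor estimates at `x`. -/

theorem le_val_comp_mono_sub {n : 𝔑} {η : Series 𝔑 R} (hη : val x < val η)
    (hn : n ∈ flatMonomials D (val η)) :
    val (D (mono n)) + val η ≤ val (comp (mono n) (x + η) - mono n) := by
  have hT := T.taylor (mono n) x η T.compId.posInf ⟨prec_iff.2 hη, fun m hm => by
    rw [mem_supp_mono] at hm
    rw [hm, T.compId.comp_id, T.compId.comp_id, prec_iff, val_mul, val_mono]
    exact hn⟩
  have hdesc : ∀ k : ℕ, val (D (mono n)) + val η ≤ val (D^[k + 1] (mono n) * η ^ (k + 1)) := by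
    intro k
    induction k with
    | zero => rw [Function.iterate_one, pow_one, val_mul]
    | succ k ih =>
      -- The descending chain compares only nonzero terms with their predecessors; zero terms
      -- satisfy the bound trivially.
      by_cases h0 : D^[k + 1 + 1] (mono n) * η ^ (k + 1 + 1) = 0
      · rw [h0, val_zero]; exact le_top
      · have h1 := hT.descending (k + 1) (by rwa [T.compId.comp_id])
        rw [T.compId.comp_id, T.compId.comp_id, prec_iff] at h1
        exact ih.trans h1.le
  apply le_val_of_forall_supp
  intro m hm
  by_contra hlt
  rw [not_le] at hlt
  apply hm
  rw [coeff_sub, hT.hasSum.2 m, finsum_eq_single _ 0, sub_eq_zero]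
  · simp only [Function.iterate_zero, id_eq, Nat.factorial_zero, Nat.cast_one, const_one, div_one,
      pow_zero, mul_one]
    rw [T.compId.comp_id]
  · intro k hk
    obtain ⟨k, rfl⟩ := Nat.exists_eq_succ_of_ne_zero hk
    apply coeff_eq_zero_of_lt_val
    refine hlt.trans_le ((hdesc k).trans ?_)
    dsimp only
    rw [T.compId.comp_id]
    have hf : ((k.succ.factorial : ℕ) : R) ≠ 0 := Nat.cast_ne_zero.2 (Nat.factorial_ne_zero _)
    have hc : (const ((k.succ.factorial : ℕ) : R) : Series 𝔑 R) ≠ 0 := by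
      intro h
      have := val_const (𝔑 := 𝔑) hf
      rw [h, val_zero] at this
      exact WithTop.top_ne_zero this
    have he : D^[k + 1] (mono n) * η ^ (k + 1) = const ((k.succ.factorial : ℕ) : R) *
        (D^[k.succ] (mono n) / const ((k.succ.factorial : ℕ) : R) * η ^ k.succ) := by
      field_simp
    rw [he, val_mul, val_const hf, zero_add]

/-- Only the dominant monomial `n` of `e` needs the Taylor condition: `n ∘ (x + η)` has the same
size as `n`, and the rest of `e`, being `≺ n`, remains `≺ n` after composition by monotonicity. -/
theorem val_lt_comp_sub {e η : Series 𝔑 R} {n : 𝔑} (hη : val x < val η) (he : val e = expo n)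
    (hn : n ∈ flatMonomials D (val η)) : val e < val (comp e (x + η) - e) := by
  have hp := T.posInf_id_add hη
  have h1 : expo n < val (comp (mono n) (x + η) - mono n) :=
    lt_of_lt_of_le hn (T.le_val_comp_mono_sub hη hn)
  have h2 : val (comp (mono n) (x + η)) = expo n := by
    rw [← val_mono (R := R) n] at h1 ⊢
    exact val_eq_of_lt_sub h1
  set c := coeff e n with hc
  have hc0 : c ≠ 0 := by
    intro h0
    have : e ≠ 0 := fun h => (expo_lt_top n).ne (by rw [← he, h, val_zero])
    obtain ⟨m, hm, hm'⟩ := exists_mem_supp_val_eq this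
    rw [he] at hm'
    have : n = m := le_antisymm (expo_le_expo.1 hm'.ge) (expo_le_expo.1 hm'.le)
    subst this
    exact hm h0
  have h3 : expo n < val (e - const c * mono n) := by
    refine lt_of_le_of_ne (le_val_sub he.ge ?_) ?_
    · rw [val_mul, val_const hc0, zero_add, val_mono]
    · intro h
      have h0 : e - const c * mono n ≠ 0 := fun h' => (expo_lt_top n).ne (by rw [h, h', val_zero])
      obtain ⟨m, hm, hm'⟩ := exists_mem_supp_val_eq h0
      have : n = m := le_antisymm (expo_le_expo.1 (h.trans hm').ge)
        (expo_le_expo.1 (h.trans hm').le)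
      subst this
      apply hm
      rw [coeff_sub, coeff_const_mul, coeff_mono_self, mul_one, sub_self]
  have h4 : expo n < val (comp (e - const c * mono n) (x + η)) := by
    rw [← h2]
    exact T.val_comp_lt hp (by rwa [val_mono])
  have h5 : comp e (x + η) - e = const c * (comp (mono n) (x + η) - mono n) +
      (comp (e - const c * mono n) (x + η) - (e - const c * mono n)) := by
    rw [T.comp_sub hp, T.composition.map_mul _ hp, T.comp_const hp]
    ring
  rw [he, h5]
  refine lt_val_add ?_ (lt_val_sub h4 h3)
  rwa [val_mul, val_const hc0, zero_add]

theorem val_lt_comp_sub_of_le {e η : Series 𝔑 R} (he : val x < val e) (h : val e ≤ val η)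
    (he0 : e ≠ 0) : val e < val (comp e (x + η) - e) := by
  obtain ⟨n, -, hn⟩ := exists_mem_supp_val_eq he0
  exact T.val_lt_comp_sub (he.trans_le h) hn (T.mem_flatMonomials_of_le (hn ▸ he) (hn ▸ h))

theorem val_comp_eq_of_le {e η : Series 𝔑 R} (he : val x < val e) (h : val e ≤ val η) :
    val (comp e (x + η)) = val e := by
  by_cases he0 : e = 0
  · rw [he0, T.comp_zero (T.posInf_id_add (he.trans_le h))]
  · exact val_eq_of_lt_sub (T.val_lt_comp_sub_of_le he h he0)

/-- The mean value estimate around the identity. -/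
theorem val_lt_comp_id_add_sub {ε η : Series 𝔑 R} (hε : val x < val ε) (hη : val x < val η)
    (h0 : η ≠ 0) : val η < val (comp ε (x + η) - ε) := by
  have hp := T.posInf_id_add hη
  have hsub : supp (comp ε (x + η) - ε) ⊆ {m | val η < expo m} := by
    apply (T.composition.stronglyLinear _ hp).supp_sub_subset
    intro n hn
    have hxn : val x < expo n := hε.trans_le (val_le_expo hn)
    have hlt : val η < val (D (mono n)) + val η := by
      conv_lhs => rw [← zero_add (val η)]
      refine (WithTop.add_lt_add_iff_right (val_ne_top h0)).2 (T.val_deriv_pos ?_)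
      rwa [val_mono]
    suffices h : val η < val (comp (mono n) (x + η) - mono n) from
      fun m hm => h.trans_le (val_le_expo hm)
    by_cases hf : n ∈ flatMonomials D (val η)
    · exact hlt.trans_le (T.le_val_comp_mono_sub hη hf)
    -- Failure of the Taylor condition means `n ≼ n' η ≺ η`. Then `n ∘ (x + η) ≺ η ∘ (x + η)`, which
    -- has the size of `η`, so both parts of the difference are negligible.
    · have h1 : val η < expo n := hlt.trans_le (not_lt.1 hf)
      rw [← val_mono (R := R) n] at h1
      refine lt_val_sub ?_ h1
      have := T.val_comp_lt hp h1
      rwa [T.val_comp_eq_of_le hη le_rfl] at this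
  by_cases hd : comp ε (x + η) - ε = 0
  · rw [hd, val_zero]
    exact lt_top_iff_ne_top.2 (val_ne_top h0)
  · obtain ⟨m, hm, hm'⟩ := exists_mem_supp_val_eq hd
    rw [hm']
    exact hsub hm

theorem le_val_comp_id_add_sub {ε η : Series 𝔑 R} (hε : val x < val ε) (hη : val x < val η) :
    val η ≤ val (comp ε (x + η) - ε) := by
  by_cases h0 : η = 0
  · rw [h0, add_zero, T.compId.comp_id, sub_self]
  · exact (T.val_lt_comp_id_add_sub hε hη h0).le

/-! Flatness of the composition law. -/

theorem log_one : log 1 = 0 := by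
  have h := T.transserial.log_mul 1 1 one_pos one_pos
  rw [mul_one] at h
  exact left_eq_add.1 h

theorem log_ne_zero {s : Series 𝔑 R} (hs : 0 < s) (h1 : s ≠ 1) : log s ≠ 0 := by
  rcases lt_or_gt_of_ne h1 with h | h
  · have := T.transserial.log_lt_log _ _ hs h
    rw [T.log_one] at this
    exact this.ne
  · have := T.transserial.log_lt_log _ _ one_pos h
    rw [T.log_one] at this
    exact this.ne'

theorem val_log_mono {n : 𝔑} (hn : n ≠ 1) : val (log (mono n)) < 0 := by
  obtain ⟨m, hm, he⟩ := exists_mem_supp_val_eq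
    (T.log_ne_zero (mono_pos n) (mono_ne_one hn))
  rw [he, ← val_one (𝔑 := 𝔑) (R := R), ← mono_one, val_mono, expo_lt_expo]
  exact T.transserial.one_lt_of_mem_supp_log n m hm

/-- In the infinite case, compare the derivatives and divide by the common size. The infinitesimal
case follows by inversion, which only changes the sign of the logarithmic derivative. -/
theorem val_logDeriv_le {s t : Series 𝔑 R} (h : val s = val t) (ht : t ≠ 0) (h0 : val s ≠ 0) :
    val (D (log |s|)) ≤ val (D (log |t|)) := by
  have hs : s ≠ 0 := fun h' => val_ne_top ht (by rw [← h, h', val_zero])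
  have key : ∀ a b : Series 𝔑 R, a ≠ 0 → b ≠ 0 → val a = val b → val a < 0 →
      val (D (log |a|)) ≤ val (D (log |b|)) := by
    intro a b ha hb hab hlt
    have h1 := T.val_deriv_le hlt hab.le
    rw [T.val_deriv_eq ha, T.val_deriv_eq hb, hab] at h1
    exact (WithTop.add_le_add_iff_right (val_ne_top hb)).1 h1
  rcases lt_or_gt_of_ne h0 with hlt | hgt
  · exact key s t hs ht h hlt
  · have hinv : ∀ a : Series 𝔑 R, a ≠ 0 → val (D (log |a⁻¹|)) = val (D (log |a|)) := by
      intro a ha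
      have h1 := T.deriv.leibniz a a⁻¹
      rw [mul_inv_cancel₀ ha, T.deriv_one] at h1
      rw [T.deriv.map_log a ha, T.deriv.map_log _ (inv_ne_zero ha), ← val_neg]
      congr 1
      field_simp
      field_simp at h1
      linear_combination h1
    have hval : ∀ a : Series 𝔑 R, a ≠ 0 → val a + val a⁻¹ = 0 := by
      intro a ha
      rw [← val_mul, mul_inv_cancel₀ ha, val_one]
    rw [← hinv s hs, ← hinv t ht]
    refine key _ _ (inv_ne_zero hs) (inv_ne_zero ht) ?_ ?_
    · have h1 := (hval s hs).trans (hval t ht).symm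
      rw [h] at h1
      exact (WithTop.add_left_inj (val_ne_top ht)).1 h1
    · have h1 := hval s hs
      rw [← WithTop.add_lt_add_iff_left (val_ne_top hs), h1, add_zero]
      exact hgt

/-- Flatness of composition: if the dominant monomial of `n ∘ (x + ρ)` and the support of `ρ`
consist of monomials `k` with `k' z ≺ k`, then so does the support of `n ∘ (x + ρ)`. -/
theorem supp_comp_subset_flatMonomials {c : WithTop (Expo 𝔑)} (hc : val x < c) {ρ : Series 𝔑 R}
    (hρ : val x < val ρ) (hρc : supp ρ ⊆ flatMonomials D c) {n d : 𝔑}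
    (hd : val (comp (mono n) (x + ρ)) = expo d) (hdc : d ∈ flatMonomials D c) :
    supp (comp (mono n) (x + ρ)) ⊆ flatMonomials D c := by
  have hp := T.posInf_id_add hρ
  by_cases hn : n = 1
  · subst hn
    rw [mono_one, T.composition.map_one _ hp, ← mono_one]
    intro k hk
    rw [mem_supp_mono.1 hk]
    exact T.one_mem_flatMonomials c
  intro k hk
  obtain ⟨d', f, v, hd', hf, -, ⟨a, ha, hv⟩, rfl⟩ := T.flat _ hp n hn k hk
  have hdd : d' = d := by
    have h1 := (val_eq_expo_of_isGreatest hd').symm.trans hd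
    exact le_antisymm (expo_le_expo.1 h1.ge) (expo_le_expo.1 h1.le)
  subst hdd
  set g := comp (mono n) (x + ρ) with hg
  have hgpos : 0 < g := T.comp_pos hp (mono_pos n)
  -- For `f`, its logarithmic derivative is dominated by that of `g`, hence by that of `d'`, which
  -- has the size of `g`. For `v`, it is dominated by that of some `a` in `supp (x + ρ)`.
  refine T.mul_mem_flatMonomials (T.mul_mem_flatMonomials hdc ?_) ?_
  · have hlog : val (log |g|) < 0 := by
      rw [abs_of_pos hgpos, hg, ← T.composition.map_log _ hp _ (mono_pos n)]
      have := T.val_comp_lt hp (f := log (mono n)) (g := 1) (by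
        rw [val_one]; exact T.val_log_mono hn)
      rwa [T.composition.map_one _ hp, val_one] at this
    have h0 : expo d' ≠ 0 := by
      intro h0
      have hn0 : val (mono n : Series 𝔑 R) ≠ val (1 : Series 𝔑 R) := by
        rw [← mono_one, val_mono, val_mono]
        intro h
        exact hn (le_antisymm (expo_le_expo.1 h.ge) (expo_le_expo.1 h.le))
      have h1 : val g = val (comp 1 (x + ρ)) := by
        rw [hd, h0, T.composition.map_one _ hp, val_one]
      rcases lt_or_gt_of_ne hn0 with h | h
      · exact (T.val_comp_lt hp h).ne h1
      · exact (T.val_comp_lt hp h).ne' h1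
    have h1 := T.val_logDeriv_le (s := mono d') (t := g) (by rw [val_mono, hd]) hgpos.ne'
      (by rwa [val_mono])
    rw [T.mem_flatMonomials_iff] at hdc ⊢
    refine hdc.trans_le (add_le_add_left (h1.trans ?_) c)
    exact (T.val_deriv_lt hlog (prec_iff.1 hf)).le
  · have hac : a ∈ flatMonomials D c := by
      obtain ⟨m, hm⟩ := T.exists_mono
      refine supp_add_subset ?_ hρc ha
      intro k hk
      rw [← hm, mem_supp_mono] at hk
      subst hk
      change expo k < val (D (mono k)) + c
      rw [hm, T.deriv_id, val_one, zero_add, ← val_mono (R := R), hm]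
      exact hc
    rw [T.mem_flatMonomials_iff] at hac ⊢
    have hv' := precEq_iff.1 hv
    -- Comparing derivatives requires `log a` to be infinite; for `a = 1` both logarithms vanish
    -- instead.
    by_cases ha1 : a = 1
    · rw [ha1, mono_one, abs_one, T.log_one, val_zero, top_le_iff, val_eq_top] at hv'
      have : log |(mono v : Series 𝔑 R)| = 0 := hv'
      rw [this, T.deriv.stronglyLinear.map_zero, val_zero, WithTop.top_add]
      exact WithTop.top_pos
    · refine hac.trans_le (add_le_add_left (T.val_deriv_le ?_ hv') c)
      rw [abs_of_pos (mono_pos a)]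
      exact T.val_log_mono ha1

end IsFlatComposable

end Flat

/-! ### Inverses of series tangent to the identity -/

section Inverse

variable {𝔑 : Type (u + 1)} [CommGroup 𝔑] [LinearOrder 𝔑] [IsOrderedMonoid 𝔑]
  {R : Type w} [Field R] [LinearOrder R] [IsStrictOrderedRing R]

/-- `x + ε` is a right inverse of `x + δ`, the support of `ε` is contained in `A`, and its elements
`k` satisfy `k' (q ∘ (x + ε)) ≺ k`. -/
structure IsFlatInverse (D : Series 𝔑 R → Series 𝔑 R)
    (comp : Series 𝔑 R → Series 𝔑 R → Series 𝔑 R) (x : Series 𝔑 R) (A : Set 𝔑)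
    (δ q ε : Series 𝔑 R) : Prop where
  supp_subset : supp ε ⊆ A
  val_lt : val x < val ε
  comp_eq : comp (x + δ) (x + ε) = x
  flat : supp ε ⊆ flatMonomials D (val (comp q (x + ε)))

namespace IsFlatComposable

variable {log D : Series 𝔑 R → Series 𝔑 R} {comp : Series 𝔑 R → Series 𝔑 R → Series 𝔑 R}
  {x : Series 𝔑 R} (T : IsFlatComposable log D comp x)

include T

theorem val_lt_comp_id_add {δ ε : Series 𝔑 R} (hδ : val x < val δ) (hε : val x < val ε) :
    val x < val (comp δ (x + ε)) := by
  have h := T.val_comp_lt (T.posInf_id_add hε) hδ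
  rwa [T.compId.id_comp _ (T.posInf_id_add hε), val_add_eq_left hε] at h

theorem id_add_comp {δ s : Series 𝔑 R} (hs : PosInf s) : comp (x + δ) s = s + comp δ s := by
  rw [T.comp_add hs, T.compId.id_comp _ hs]

theorem comp_eq_id_symm {s t : Series 𝔑 R} (hs : PosInf s) (ht : PosInf t) (h : comp s t = x) :
    comp t s = x := by
  apply T.comp_injective ht
  rw [← T.composition.assoc s t hs ht, h, T.compId.comp_id, T.compId.id_comp t ht]

/-- Two-sidedness gives `η = -θ ∘ (x + η)`; if `η ≺ θ`, the right side would have the size of `θ`.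
-/
theorem val_le_of_comp_eq_id {η θ : Series 𝔑 R} (hη : val x < val η) (hθ : val x < val θ)
    (h : comp (x + η) (x + θ) = x) : val η ≤ val θ := by
  by_contra hlt
  have h1 := T.comp_eq_id_symm (T.posInf_id_add hη) (T.posInf_id_add hθ) h
  rw [T.id_add_comp (T.posInf_id_add hη), add_assoc, add_eq_left, add_eq_zero_iff_eq_neg] at h1
  have h2 := T.val_comp_eq_of_le hθ (not_le.1 hlt).le
  rw [← val_neg, ← h1] at h2
  exact hlt h2.le

theorem le_val_comp_id_add {f θ : Series 𝔑 R} {c : WithTop (Expo 𝔑)} (hf : val x < val f)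
    (hθ : val x < val θ) (hcf : c ≤ val f) (hcθ : c ≤ val θ) : c ≤ val (comp f (x + θ)) := by
  rcases le_total (val f) (val θ) with h | h
  · rwa [T.val_comp_eq_of_le hf h]
  · have h1 := T.val_comp_le (T.posInf_id_add hθ) h
    rw [T.val_comp_eq_of_le hθ le_rfl] at h1
    exact hcθ.trans h1

/-- Inversion of `x + y` when the monomials in the support of `y` have Taylor expansions at `x`
with increment `y`. -/
theorem exists_inverse_of_supp_subset_flatMonomials {A : Set 𝔑}
    (hA : ∀ δ : Series 𝔑 R, supp δ ⊆ A → val x < val δ → ∀ m ∈ A,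
      supp (comp (mono m) (x + δ)) ⊆ A)
    {c : WithTop (Expo 𝔑)} (hc : val x < c) {y : Series 𝔑 R} (hy : c ≤ val y) (hyA : supp y ⊆ A)
    (hyc : supp y ⊆ flatMonomials D c) :
    ∃ θ : Series 𝔑 R, supp θ ⊆ A ∧ supp θ ⊆ flatMonomials D c ∧ val x < val θ ∧
      comp (x + y) (x + θ) = x := by
  have hxy := hc.trans_le hy
  have hp := T.posInf_id_add hxy
  -- `Y` is a small set of monomials, stable under composition with `x + y`, on which the operator
  -- is contracting; flatness keeps the closure inside the good monomials.
  obtain ⟨Y, hYs, hyY, hYH, hYF⟩ := exists_small_closure (isWellBased_supp y).1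
    (Set.subset_inter hyA hyc) (fun n => supp (comp (mono n) (x + y)))
    (fun n => (isWellBased_supp _).1) (fun n hn => Set.subset_inter (hA y hyA hxy n hn.1) (by
      have h1 := T.val_lt_comp_sub hxy (val_mono n) (flatMonomials_mono D hy hn.2)
      refine T.supp_comp_subset_flatMonomials hc hxy hyc (d := n) ?_ hn.2
      rw [val_eq_of_lt_sub h1, val_mono]))
  obtain ⟨θ, hθY, hθ⟩ := exists_eq_of_contracting hYs (fun f => comp f (x + y))
    (fun f g => T.comp_sub hp f g)
    (fun f hf => (T.composition.stronglyLinear _ hp).supp_subset fun n hn => hYF n (hf hn))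
    (fun f hf h0 => by
      obtain ⟨n, hn, he⟩ := exists_mem_supp_val_eq h0
      exact T.val_lt_comp_sub hxy he (flatMonomials_mono D hy (hYH (hf hn)).2))
    (-y) (by rwa [supp_neg])
  have hxθ : val x < val θ := by
    by_contra hlt
    have h1 := T.val_comp_le hp (not_lt.1 hlt)
    rw [hθ, T.compId.id_comp _ hp, val_neg, val_add_eq_left hxy] at h1
    exact absurd hxy (not_lt.2 h1)
  refine ⟨θ, fun n hn => (hYH (hθY hn)).1, fun n hn => (hYH (hθY hn)).2, hxθ, ?_⟩
  apply T.comp_eq_id_symm (T.posInf_id_add hxθ) hp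
  rw [T.id_add_comp hp, hθ, add_neg_cancel_right]

/-- With `x + η = (x + δ₂) ∘ (x + ε₁)` and `x + θ = (x + δ₁) ∘ (x + ε₂)`, the two are mutually
inverse, so `θ ≼ η ≼ m ∘ (x + ε₁)`. Since `x + ε₂ = (x + ε₁) ∘ (x + θ)`, the mean value estimate
bounds `ε₂ - ε₁` by `θ`. -/
theorem le_val_inverse_sub {δ₁ δ₂ ε₁ ε₂ : Series 𝔑 R} {m : 𝔑} (hm : val x < expo m)
    (hδ₁ : val x < val δ₁) (hε₁ : val x < val ε₁) (hδ₂ : val x < val δ₂) (hε₂ : val x < val ε₂)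
    (h₁ : comp (x + δ₁) (x + ε₁) = x) (h₂ : comp (x + δ₂) (x + ε₂) = x)
    (hsub : expo m ≤ val (δ₂ - δ₁)) : val (comp (mono m) (x + ε₁)) ≤ val (ε₂ - ε₁) := by
  have ps₁ := T.posInf_id_add hδ₁
  have ps₂ := T.posInf_id_add hδ₂
  have pt₁ := T.posInf_id_add hε₁
  have pt₂ := T.posInf_id_add hε₂
  obtain ⟨η, hη⟩ : ∃ η, η = comp (δ₂ - δ₁) (x + ε₁) := ⟨_, rfl⟩
  have hηm : val (comp (mono m) (x + ε₁)) ≤ val η := by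
    rw [hη]
    exact T.val_comp_le pt₁ (by rwa [val_mono])
  have hxη : val x < val η := by
    rw [hη]
    exact T.val_lt_comp_id_add (hm.trans_le hsub) hε₁
  obtain ⟨θ, hθ⟩ : ∃ θ, θ = ε₂ + comp δ₁ (x + ε₂) := ⟨_, rfl⟩
  have hxθ : val x < val θ := by
    rw [hθ]
    exact lt_val_add hε₂ (T.val_lt_comp_id_add hδ₁ hε₂)
  have e₁ : comp (x + δ₁) (x + ε₂) = x + θ := by
    rw [T.id_add_comp pt₂, hθ, add_assoc]
  have e₂ : comp (x + δ₂) (x + ε₁) = x + η := by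
    have h : x + δ₂ = (x + δ₁) + (δ₂ - δ₁) := by ring
    rw [h, T.comp_add pt₁, h₁, hη]
  have e₃ : comp (x + ε₁) (x + θ) = x + ε₂ := by
    rw [← e₁, T.composition.assoc _ _ ps₁ pt₂, T.comp_eq_id_symm ps₁ pt₁ h₁,
      T.compId.id_comp _ pt₂]
  have e₄ : comp (x + η) (x + θ) = x := by
    rw [← e₂, ← T.composition.assoc _ _ pt₁ (T.posInf_id_add hxθ), e₃, h₂]
  have h3 := hηm.trans (T.val_le_of_comp_eq_id hxη hxθ e₄)
  rw [T.id_add_comp (T.posInf_id_add hxθ), add_assoc, add_right_inj] at e₃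
  have e₅ : ε₂ - ε₁ = θ + (comp ε₁ (x + θ) - ε₁) := by rw [← e₃]; ring
  rw [e₅]
  exact le_val_add h3 (h3.trans (T.le_val_comp_id_add_sub hε₁ hxθ))

/-- If `x + ε₁` inverts `x + δ₁` and `ε` is close to `ε₁`, then `x + ε` is close to an inverse of
`x + δ`, and composition of `m` with `x + ε₁` and `x + ε` is the same up to a factor. -/
theorem approx_inverse {δ δ₁ ε ε₁ : Series 𝔑 R} {m : 𝔑} (hm : val x < expo m)
    (hδ : val x < val δ) (hδ₁ : val x < val δ₁) (hε₁ : val x < val ε₁)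
    (h₁ : comp (x + δ₁) (x + ε₁) = x) (hsub : expo m ≤ val (δ - δ₁))
    (hε : val (comp (mono m) (x + ε₁)) ≤ val (ε - ε₁)) :
    val (comp (mono m) (x + ε₁)) ≤ val (ε + comp δ (x + ε)) ∧
      val (comp (mono m) (x + ε)) = val (comp (mono m) (x + ε₁)) := by
  have ps₁ := T.posInf_id_add hδ₁
  have pt₁ := T.posInf_id_add hε₁
  -- Chosen so that `x + ε = (x + ρ) ∘ (x + ε₁)`, which reduces everything to a perturbation `ρ ≼ m`
  -- at `x`.
  obtain ⟨ρ, hρ⟩ : ∃ ρ, ρ = comp (ε - ε₁) (x + δ₁) := ⟨_, rfl⟩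
  have hmρ : expo m ≤ val ρ := by
    have h := T.val_comp_le ps₁ hε
    rwa [← hρ, ← T.composition.assoc _ _ pt₁ ps₁, T.comp_eq_id_symm ps₁ pt₁ h₁,
      T.compId.comp_id, val_mono] at h
  have hxρ := hm.trans_le hmρ
  have pρ := T.posInf_id_add hxρ
  have et : comp (x + ρ) (x + ε₁) = x + ε := by
    rw [T.id_add_comp pt₁, hρ, ← T.composition.assoc _ _ ps₁ pt₁, h₁, T.compId.comp_id]
    ring
  constructor
  · obtain ⟨E, hE⟩ : ∃ E, E = (δ - δ₁) + ρ + (comp δ (x + ρ) - δ) := ⟨_, rfl⟩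
    have hmE : expo m ≤ val E := by
      rw [hE]
      exact le_val_add (le_val_add hsub hmρ) (hmρ.trans (T.le_val_comp_id_add_sub hδ hxρ))
    have e₁ : comp (x + δ) (x + ρ) = (x + δ₁) + E := by
      rw [T.id_add_comp pρ, hE]; ring
    have hxε : val x < val ε := by
      have h : ε = ε₁ + (ε - ε₁) := by ring
      rw [h]
      refine lt_val_add hε₁ (lt_of_lt_of_le (T.val_lt_comp_id_add ?_ hε₁) hε)
      rwa [val_mono]
    have e₂ : comp (x + δ) (x + ε) = x + comp E (x + ε₁) := by
      rw [← et, T.composition.assoc _ _ pρ pt₁, e₁, T.comp_add pt₁, h₁]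
    rw [T.id_add_comp (T.posInf_id_add hxε), add_assoc, add_right_inj] at e₂
    rw [e₂]
    exact T.val_comp_le pt₁ (by rwa [val_mono])
  · have h := T.val_comp_eq_of_le (e := mono m) (η := ρ) (by rwa [val_mono]) (by rwa [val_mono])
    rw [← et, T.composition.assoc _ _ pρ pt₁]
    exact le_antisymm (T.val_comp_le pt₁ h.le) (T.val_comp_le pt₁ h.ge)

/-- The induction step: glue the inverses of the truncations to a pseudo-limit, then correct the
remaining error by the contracting case. -/
theorem exists_flatInverse_of_trunc {A : Set 𝔑}
    (hA : ∀ δ : Series 𝔑 R, supp δ ⊆ A → val x < val δ → ∀ m ∈ A,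
      supp (comp (mono m) (x + δ)) ⊆ A)
    {δ q : Series 𝔑 R} (hδA : supp δ ⊆ A) (hδ : val x < val δ) (hq : val x < val q)
    (hqδ : ∀ m ∈ supp δ, expo m ≤ val q)
    (ih : ∀ m ∈ supp δ, ∃ ε, IsFlatInverse D comp x A (trunc δ m) (mono m) ε) :
    ∃ ε, IsFlatInverse D comp x A δ q ε := by
  choose! e he using ih
  have hxm : ∀ m ∈ supp δ, val x < expo m := fun m hm => hδ.trans_le (val_le_expo hm)
  have hxtr : ∀ m, val x < val (trunc δ m) := fun m => hδ.trans_le (le_val_trunc m)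
  have hcoh : ∀ m ∈ supp δ, ∀ m' ∈ supp δ, m' ≤ m →
      val (comp (mono m) (x + e m)) ≤ val (e m' - e m) := by
    intro m hm m' hm' hle
    refine T.le_val_inverse_sub (hxm m hm) (hxtr m) (he m hm).val_lt (hxtr m') (he m' hm').val_lt
      (he m hm).comp_eq (he m' hm').comp_eq ?_
    rw [← trunc_trunc hle]
    exact expo_le_val_sub_trunc _ m
  obtain ⟨ε, hεs, hε⟩ := exists_pseudoLimit (fun m : supp δ => e m.1)
    (fun m : supp δ => val (comp (mono m.1) (x + e m.1))) (fun i j => by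
      rcases le_total j.1 i.1 with h | h
      · exact Or.inl (hcoh i.1 i.2 j.1 j.2 h)
      · right
        rw [val_sub_comm (e j.1)]
        exact hcoh j.1 j.2 i.1 i.2 h)
    (@small_iUnion _ _ (isWellBased_supp δ).1 _ fun m => (isWellBased_supp _).1)
  have hεA : supp ε ⊆ A := hεs.trans (Set.iUnion_subset fun m => (he m.1 m.2).supp_subset)
  have hxε : val x < val ε := by
    by_cases h0 : ε = 0
    · rw [h0, val_zero]
      exact T.val_id_neg.trans_le le_top
    · obtain ⟨n, hn, hv⟩ := exists_mem_supp_val_eq h0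
      obtain ⟨m, hm⟩ := Set.mem_iUnion.1 (hεs hn)
      rw [hv]
      exact (he m.1 m.2).val_lt.trans_le (val_le_expo hm)
  have pt := T.posInf_id_add hxε
  have happ : ∀ m ∈ supp δ, _ := fun m hm =>
    T.approx_inverse (hxm m hm) hδ (hxtr m) (he m hm).val_lt (he m hm).comp_eq
      (expo_le_val_sub_trunc δ m) (hε ⟨m, hm⟩)
  obtain ⟨y, hy⟩ : ∃ y, y = ε + comp δ (x + ε) := ⟨_, rfl⟩
  have hst : comp (x + δ) (x + ε) = x + y := by rw [T.id_add_comp pt, hy, add_assoc]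
  have hxy : val x < val y := by
    rw [hy]
    exact lt_val_add hxε (T.val_lt_comp_id_add hδ hxε)
  have hxqt := T.val_lt_comp_id_add hq hxε
  -- As a size, `c` is the larger of `y` and `q ∘ (x + ε)`: the first is needed to invert `x + y`,
  -- the second for the flatness of the result.
  obtain ⟨c, hc⟩ : ∃ c, c = min (val y) (val (comp q (x + ε))) := ⟨_, rfl⟩
  have hxc : val x < c := by
    rw [hc]
    exact lt_min hxy hxqt
  have hcy : c ≤ val y := hc ▸ min_le_left _ _
  have hcq : c ≤ val (comp q (x + ε)) := hc ▸ min_le_right _ _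
  have hcm : ∀ m ∈ supp δ, val (comp (mono m) (x + e m)) ≤ c := by
    intro m hm
    rw [hc, hy]
    refine le_min (happ m hm).1 ?_
    rw [← (happ m hm).2]
    exact T.val_comp_le pt (by rw [val_mono]; exact hqδ m hm)
  -- Each monomial of `ε` comes from some `e m`, and is good for increments of size `m ∘ (x + e m)`,
  -- hence for the smaller size `c`.
  have hεc : supp ε ⊆ flatMonomials D c := hεs.trans (Set.iUnion_subset fun m =>
    (he m.1 m.2).flat.trans (flatMonomials_mono D (hcm m.1 m.2)))
  have hyA : supp y ⊆ A := by
    rw [hy]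
    exact supp_add_subset hεA ((T.composition.stronglyLinear _ pt).supp_subset fun m hm =>
      hA ε hεA hxε m (hδA hm))
  have hyc : supp y ⊆ flatMonomials D c := by
    rw [hy]
    refine supp_add_subset hεc ((T.composition.stronglyLinear _ pt).supp_subset fun m hm => ?_)
    obtain ⟨d, -, hd⟩ := exists_mem_supp_val_eq (T.comp_ne_zero pt (mono_ne_zero m))
    refine T.supp_comp_subset_flatMonomials hxc hxε hεc hd (T.mem_flatMonomials_of_le ?_ ?_)
    · rw [← hd]
      exact T.val_lt_comp_id_add (by rw [val_mono]; exact hxm m hm) hxε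
    · rw [← hd, (happ m hm).2]
      exact hcm m hm
  obtain ⟨θ, hθA, hθc, hxθ, hθ⟩ :=
    T.exists_inverse_of_supp_subset_flatMonomials hA hxc hcy hyA hyc
  have pθ := T.posInf_id_add hxθ
  have hcθ : c ≤ val θ := hcy.trans (T.val_le_of_comp_eq_id hxy hxθ hθ)
  have et : comp (x + ε) (x + θ) = x + (θ + comp ε (x + θ)) := by
    rw [T.id_add_comp pθ, add_assoc]
  have hxe : val x < val (θ + comp ε (x + θ)) := lt_val_add hxθ (T.val_lt_comp_id_add hxε hxθ)
  refine ⟨θ + comp ε (x + θ), ?_, hxe, ?_, ?_⟩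
  · exact supp_add_subset hθA ((T.composition.stronglyLinear _ pθ).supp_subset fun m hm =>
      hA θ hθA hxθ m (hεA hm))
  · rw [← et, T.composition.assoc _ _ pt pθ, hst, hθ]
  · rw [← et, T.composition.assoc _ _ pt pθ]
    -- Neither `θ` nor `q ∘ (x + ε)` exceeds the size `c`, so composing the latter with `x + θ` does
    -- not exceed it either, and goodness at `c` suffices.
    refine Set.Subset.trans ?_
      (flatMonomials_mono D (T.le_val_comp_id_add hxqt hxθ hcq hcθ))
    refine supp_add_subset hθc ((T.composition.stronglyLinear _ pθ).supp_subset fun n hn => ?_)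
    have h1 := T.val_lt_comp_sub hxθ (val_mono n) (flatMonomials_mono D hcθ (hεc hn))
    refine T.supp_comp_subset_flatMonomials hxc hxθ hθc (d := n) ?_ (hεc hn)
    rw [val_eq_of_lt_sub h1, val_mono]

theorem exists_inverse {A : Set 𝔑}
    (hA : ∀ δ : Series 𝔑 R, supp δ ⊆ A → val x < val δ → ∀ m ∈ A,
      supp (comp (mono m) (x + δ)) ⊆ A)
    {δ : Series 𝔑 R} (hδA : supp δ ⊆ A) (hδ : val x < val δ) :
    ∃ ε, supp ε ⊆ A ∧ val x < val ε ∧ comp (x + δ) (x + ε) = x := by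
  have key : ∀ m ∈ supp δ, ∃ ε, IsFlatInverse D comp x A (trunc δ m) (mono m) ε := by
    intro m hm
    refine (isWellBased_supp δ).2.induction hm (P := fun m => ∃ ε, IsFlatInverse D comp x A
      (trunc δ m) (mono m) ε) fun m hm ih => ?_
    refine T.exists_flatInverse_of_trunc hA (fun n hn => hδA (mem_supp_trunc.1 hn).1)
      (hδ.trans_le (le_val_trunc m)) ?_ (fun n hn => ?_) fun n hn => ?_
    · rw [val_mono]
      exact hδ.trans_le (val_le_expo hm)
    · rw [val_mono, expo_le_expo]
      exact (mem_supp_trunc.1 hn).2.le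
    · obtain ⟨hn1, hn2⟩ := mem_supp_trunc.1 hn
      rw [trunc_trunc hn2.le]
      exact ih n hn1 hn2
  -- With `q = 0` the valuation is `⊤` and the flatness requirement is void.
  obtain ⟨ε, hε⟩ := T.exists_flatInverse_of_trunc hA hδA hδ (q := 0)
    (by rw [val_zero]; exact T.val_id_neg.trans_le le_top)
    (fun m _ => by rw [val_zero]; exact le_top) key
  exact ⟨ε, hε.supp_subset, hε.val_lt, hε.comp_eq⟩

end IsFlatComposable

end Inverse

end Transserial

/-! ### The group structure. -/

open Transserial in
theorem theorem3p1 {𝔑 : Type (u + 1)} [CommGroup 𝔑] [LinearOrder 𝔑] [IsOrderedMonoid 𝔑]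
    [Nontrivial 𝔑] {R : Type w} [Field R] [LinearOrder R] [IsStrictOrderedRing R]
    (log D : Series 𝔑 R → Series 𝔑 R) (comp : Series 𝔑 R → Series 𝔑 R → Series 𝔑 R)
    (x : Series 𝔑 R)
    (hlog : IsTransserialField log) (hexp : IsExponentiallyClosed log)
    (hD : IsTransserialDerivation log D) (hDx : IsDerivIdentity D x)
    (hH : IsHField D) (hDflat : IsFlatDerivation log D x)
    (hcomp : IsTransserialComposition log comp) (hcompx : IsCompIdentity comp x)
    (hcompflat : IsFlatComposition log comp)
    (hchain : SatisfiesChainRule D comp) (htaylor : HasTaylorExpansions D comp)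
    (𝔐 : Subgroup 𝔑) (hx : ∃ m ∈ 𝔐, mono m = x)
    (hSD : ∀ s ∈ seriesOver R 𝔐, D s ∈ seriesOver R 𝔐)
    (hScomp : ∀ m ∈ 𝔐, ∀ δ ∈ seriesOver R 𝔐, δ ≺ x → comp (mono m) (x + δ) ∈ seriesOver R 𝔐) :
    ∃ _ : Group ↥(tangentToIdentity 𝔐 x),
      (∀ f g : ↥(tangentToIdentity 𝔐 x), ((f * g : ↥(tangentToIdentity 𝔐 x)) : Series 𝔑 R) =
        comp (f : Series 𝔑 R) (g : Series 𝔑 R)) ∧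
      ((1 : ↥(tangentToIdentity 𝔐 x)) : Series 𝔑 R) = x := by
  have T : IsFlatComposable log D comp x :=
    ⟨hlog, hD, hH, hDx.deriv_eq_one, hcomp, hcompx, hcompflat, htaylor,
      hx.imp fun _ h => h.2⟩
  have hA : ∀ δ : Series 𝔑 R, supp δ ⊆ (𝔐 : Set 𝔑) → val x < val δ → ∀ m ∈ (𝔐 : Set 𝔑),
      supp (comp (mono m) (x + δ)) ⊆ (𝔐 : Set 𝔑) :=
    fun δ hδ hv m hm => hScomp m hm δ hδ (prec_iff.2 hv)
  have hxA : supp x ⊆ (𝔐 : Set 𝔑) := by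
    obtain ⟨m, hm, rfl⟩ := hx
    intro n hn
    rw [mem_supp_mono.1 hn]
    exact hm
  have hmem : ∀ s, s ∈ tangentToIdentity 𝔐 x ↔
      ∃ δ, supp δ ⊆ (𝔐 : Set 𝔑) ∧ val x < val δ ∧ s = x + δ := by
    intro s
    constructor
    · rintro ⟨hs, δ, hδ, rfl⟩
      refine ⟨δ, ?_, prec_iff.1 hδ, rfl⟩
      rw [← add_sub_cancel_left x δ]
      exact supp_sub_subset hs hxA
    · rintro ⟨δ, hδ, hv, rfl⟩
      exact ⟨supp_add_subset hxA hδ, δ, prec_iff.2 hv, rfl⟩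
  have hpos : ∀ s ∈ tangentToIdentity 𝔐 x, PosInf s := by
    intro s hs
    obtain ⟨δ, -, hv, rfl⟩ := (hmem s).1 hs
    exact T.posInf_id_add hv
  have hmul : ∀ s ∈ tangentToIdentity 𝔐 x, ∀ t ∈ tangentToIdentity 𝔐 x,
      comp s t ∈ tangentToIdentity 𝔐 x := by
    intro s hs t ht
    have pt := hpos t ht
    obtain ⟨δ, hδ, hδv, rfl⟩ := (hmem s).1 hs
    obtain ⟨ε, hε, hεv, rfl⟩ := (hmem t).1 ht
    refine (hmem _).2 ⟨ε + comp δ (x + ε), ?_, ?_, ?_⟩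
    · exact supp_add_subset hε ((T.composition.stronglyLinear _ pt).supp_subset fun m hm =>
        hA ε hε hεv m (hδ hm))
    · exact lt_val_add hεv (T.val_lt_comp_id_add hδv hεv)
    · rw [T.id_add_comp pt, add_assoc]
  have hinv : ∀ s : ↥(tangentToIdentity 𝔐 x), ∃ t : ↥(tangentToIdentity 𝔐 x),
      comp t.1 s.1 = x := by
    rintro ⟨s, hs⟩
    obtain ⟨δ, hδ, hδv, rfl⟩ := (hmem s).1 hs
    obtain ⟨ε, hε, hεv, h⟩ := T.exists_inverse hA hδ hδv
    exact ⟨⟨x + ε, (hmem _).2 ⟨ε, hε, hεv, rfl⟩⟩,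
      T.comp_eq_id_symm (T.posInf_id_add hδv) (T.posInf_id_add hεv) h⟩
  have hone : x ∈ tangentToIdentity 𝔐 x :=
    (hmem x).2 ⟨0, by rw [supp_zero]; exact Set.empty_subset _,
      by rw [val_zero]; exact T.val_id_neg.trans_le le_top, (add_zero x).symm⟩
  choose inv hinv using hinv
  let _ : Mul ↥(tangentToIdentity 𝔐 x) := ⟨fun s t => ⟨comp s.1 t.1, hmul s.1 s.2 t.1 t.2⟩⟩
  let _ : One ↥(tangentToIdentity 𝔐 x) := ⟨⟨x, hone⟩⟩
  let _ : Inv ↥(tangentToIdentity 𝔐 x) := ⟨inv⟩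
  refine ⟨Group.ofLeftAxioms (fun a b c => Subtype.ext ?_) (fun a => Subtype.ext ?_)
    (fun a => Subtype.ext (hinv a)), fun _ _ => rfl, rfl⟩
  · exact (hcomp.assoc b.1 c.1 (hpos _ b.2) (hpos _ c.2) a.1).symm
  · exact hcompx.id_comp a.1 (hpos _ a.2)
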